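/- Let $q\ge 0$ and $k\ge 1$ be integers, and let $|\cdot|$ be the Euclidean norm on $\mathbb{R}^q$. For finite non-empty samples $A=(a_i)_{i\le n_1}$, $B=(b_j)_{j\le n_2}$ in $\mathbb{R}^q$ and $\alpha>0$ put $$\mu_\alpha(A,B)=\frac1{n_1n_2}\sum_{i=1}^{n_1}\sum_{j=1}^{n_2}|a_i-b_j|^\alpha,\qquad d_\alpha(A,B)=\frac{n_1n_2}{n_1+n_2}\bigl(2\mu_\alpha(A,B)-\mu_\alpha(A,A)-\mu_\alpha(B,B)\bigr).$$ Let $U_1,\dots,U_{k+1}$ be samples (the residuals of $k+1$ regimes) of sizes $n_1,\dots,n_{k+1}\ge 1$, let $T=n_1+\dots+n_{k+1}$, let $U$ be the pooled sample of all $T$ observations, and define the total dispersion, the multi-sample energy distance and the within-sample dispersion by $$T_\alpha=\frac T2\,\mu_\alpha(U,U),\qquad S_\alpha=\sum_{1\le i<j\le k+1}\frac{n_i+n_j}{2T}\,d_\alpha(U_i,U_j),\qquad W_\alpha=\sum_{j=1}^{k+1}\frac{n_j}{2}\,\mu_\alpha(U_j,U_j).$$ (1) For every $\alpha>0$ and all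 such samples, $T_\alpha=S_\alpha+W_\alpha$. (2) Let $\alpha\in(0,2)$. Let $U_1,\dots,U_{k+1}$ be mutually independent, $U_j$ consisting of $n_j$ independent observations with distribution $F_j$ on $\mathbb{R}^q$. For testing $H_0:F_1=\dots=F_{k+1}$ against the alternative that $F_i\ne F_j$ for some $i,j$, the statistic $$F_\alpha=\frac{S_\alpha/k}{W_\alpha/(T-k-1)}\in[0,\infty]$$ (with $x/0=\infty$ for $x>0$ and $0/0=0$) is consistent against all alternatives with finite second moments, in the following sense. For $a\in(0,1)$ let $c_a(n_1,\dots,n_{k+1})\in[0,\infty]$ be the infimum of all $c$ such that, for sample sizes $n_1,\dots,n_{k+1}$, $P(F_\alpha>c)\le a$ whenever $F_1=\dots=F_{k+1}$. Then for every $a\in(0,1)$ the test that rejects $H_0$ when $F_\alpha>c_a(n_1,\dots,n_{k+1})$ has level $a$, that is, $P(F_\alpha>c_a(n_1,\dots,n_{k+1}))\le a$ for all sample sizes and all $F_1=\dots=F_{k+1}$; and for all fixed distributions $F_1,\dots,F_{k+1}$ with finite second moments that are not all equal, $P(F_\alpha>c_a(n_1,\dots,n_{k+1}))\to1$ along every sequence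 of sample sizes with $n_j\to\infty$ for each $j$. -/

import Mathlib

open MeasureTheory Filter Topology
open scoped ENNReal

noncomputable section

namespace EnergyTest

/-- `μ_α(A, B) = (1 / (n₁ n₂)) ∑ᵢ ∑ⱼ |aᵢ - bⱼ|^α` for finite samples `A = (aᵢ)`, `B = (bⱼ)` in `ℝ^q`. -/
def meanDist {q : ℕ} {ι κ : Type} [Fintype ι] [Fintype κ] (α : ℝ)
    (A : ι → EuclideanSpace ℝ (Fin q)) (B : κ → EuclideanSpace ℝ (Fin q)) : ℝ :=
  1 / ((Fintype.card ι : ℝ) * (Fintype.card κ : ℝ)) * ∑ i, ∑ j, ‖A i - B j‖ ^ α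

/-- The two-sample empirical energy distance
`d_α(A, B) = (n m / (n + m)) (2 μ_α(A, B) - μ_α(A, A) - μ_α(B, B))`. -/
def energyDist {q n m : ℕ} (α : ℝ)
    (A : Fin n → EuclideanSpace ℝ (Fin q)) (B : Fin m → EuclideanSpace ℝ (Fin q)) : ℝ :=
  ((n : ℝ) * (m : ℝ)) / ((n : ℝ) + (m : ℝ)) *
    (2 * meanDist α A B - meanDist α A A - meanDist α B B)

/-- A family of `k + 1` finite samples `U_1, …, U_{k+1}` in `ℝ^q`, of sizes `n_1, …, n_{k+1}`. -/
abbrev Samples (q : ℕ) {k : ℕ} (n : Fin (k + 1) → ℕ) : Type :=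
  (j : Fin (k + 1)) → Fin (n j) → EuclideanSpace ℝ (Fin q)

/-- The total number of observations `T = n_1 + ⋯ + n_{k+1}`. -/
def totalSize {k : ℕ} (n : Fin (k + 1) → ℕ) : ℕ := ∑ j, n j

/-- The pooled sample. -/
def pooled {q k : ℕ} {n : Fin (k + 1) → ℕ} (U : Samples q n) :
    (Σ j : Fin (k + 1), Fin (n j)) → EuclideanSpace ℝ (Fin q) :=
  fun p => U p.1 p.2

/-- Total dispersion `T_α = (T / 2) μ_α(U, U)`, `U` the pooled sample. -/
def totalDispersion {q k : ℕ} {n : Fin (k + 1) → ℕ} (α : ℝ) (U : Samples q n) : ℝ :=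
  (totalSize n : ℝ) / 2 * meanDist α (pooled U) (pooled U)

/-- Within-sample dispersion `W_α = ∑ⱼ (n_j / 2) μ_α(U_j, U_j)`. -/
def withinDispersion {q k : ℕ} {n : Fin (k + 1) → ℕ} (α : ℝ) (U : Samples q n) : ℝ :=
  ∑ j, (n j : ℝ) / 2 * meanDist α (U j) (U j)

/-- Multi-sample energy distance `S_α = ∑_{i < j} ((n_i + n_j) / (2 T)) d_α(U_i, U_j)`. -/
def multiEnergyDist {q k : ℕ} {n : Fin (k + 1) → ℕ} (α : ℝ) (U : Samples q n) : ℝ :=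
  ∑ i, ∑ j, if i < j then
    ((n i : ℝ) + (n j : ℝ)) / (2 * (totalSize n : ℝ)) * energyDist α (U i) (U j) else 0

/-- The ratio statistic `F_α = (S_α / k) / (W_α / (T - k - 1))`, with values in `[0, ∞]`:
if the denominator vanishes, it is `∞` for a positive numerator and `0` for a zero numerator. -/
def ratioStat {q k : ℕ} {n : Fin (k + 1) → ℕ} (α : ℝ) (U : Samples q n) : ℝ≥0∞ :=
  ENNReal.ofReal (multiEnergyDist α U / (k : ℝ)) /
    ENNReal.ofReal (withinDispersion α U / ((totalSize n : ℝ) - (k : ℝ) - 1))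

/-- The law of `k + 1` mutually independent samples, the `j`-th one consisting of `n_j`
independent observations with distribution `F_j`. -/
def sampleLaw {q k : ℕ} (n : Fin (k + 1) → ℕ)
    (F : Fin (k + 1) → Measure (EuclideanSpace ℝ (Fin q))) : Measure (Samples q n) :=
  Measure.pi fun j => Measure.pi fun _ : Fin (n j) => F j

/-- The probability that the test which rejects when `F_α` exceeds `c` rejects,
under the distributions `F_1, …, F_{k+1}`. -/
def rejectionProb {q k : ℕ} (α : ℝ) (n : Fin (k + 1) → ℕ) (c : ℝ≥0∞)
    (F : Fin (k + 1) → Measure (EuclideanSpace ℝ (Fin q))) : ℝ≥0∞ :=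
  sampleLaw n F {U | c < ratioStat α U}

/-- The level-`a` critical value for the sample sizes `n`: the infimum of all `c` such that,
whatever the common distribution `G` under the null hypothesis `F_1 = ⋯ = F_{k+1} = G`,
the statistic exceeds `c` with probability at most `a`. -/
def criticalValue (q : ℕ) {k : ℕ} (α : ℝ) (n : Fin (k + 1) → ℕ) (a : ℝ) : ℝ≥0∞ :=
  sInf {c | ∀ G : Measure (EuclideanSpace ℝ (Fin q)), IsProbabilityMeasure G →
    rejectionProb α n c (fun _ => G) ≤ ENNReal.ofReal a}

end EnergyTest

end

noncomputable section

namespace EnergyTest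

/-! The decomposition is bookkeeping: the weight of each pair of samples cancels the denominator of
its energy distance. The level holds because the infimum defining the critical value is attained, by
continuity of measure along a decreasing sequence of thresholds.

Consistency compares three orders of magnitude. First, critical values stay bounded: once `T` is
large, `criticalValue_le` gives `2 / a`. Under the null hypothesis the pooled observations are
exchangeable, so all pairs of distinct observations have the same expected share of the total
dispersion. This yields `E[S_α / T_α] ≤ k / (T - 1)`, and Markov's inequality applies. As `S_α /
T_α` lies in `[0, 1]`, no moments are needed and the bound is uniform over all null laws.

Second, `W_α / T` is bounded in mean, because `‖x - y‖ ^ α` is dominated by second moments.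

Third, `S_α` grows at least linearly in the smallest sample size. The kernel `‖x - y‖ ^ α` is a
mixture of `1 - exp (-s ‖x - y‖ ^ 2)`, and Gaussians are Fourier transforms of Gaussians; hence an
energy distance dominates a Gaussian-weighted `L²` distance of empirical characteristic functions
(`exists_mul_integral_fourierSq_le`). These converge in mean square to the true characteristic
functions, which differ for distinct laws (`exists_mul_sub_le_multiEnergyDist`). -/

/-! ### Powers as mixtures of exponentials -/

theorem integrableOn_one_sub_exp_mul_rpow {p : ℝ} (hp0 : 0 < p) (hp1 : p < 1) {u : ℝ}
    (hu : 0 ≤ u) :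
    IntegrableOn (fun s : ℝ => (1 - Real.exp (-(s * u))) * s ^ (-1 - p)) (Set.Ioi 0) := by
  have hmeas : Measurable fun s : ℝ => (1 - Real.exp (-(s * u))) * s ^ (-1 - p) := by fun_prop
  -- Near `0` the integrand is at most `u * s ^ (-p)`, integrable since `p < 1`; beyond `1` it is at
  -- most `s ^ (-1 - p)`, integrable since `0 < p`.
  rw [← Set.Ioc_union_Ioi_eq_Ioi zero_le_one]
  refine IntegrableOn.union ?_ ?_
  · have h1 : IntegrableOn (fun s : ℝ => u * s ^ (-p)) (Set.Ioc 0 1) := by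
      have := (intervalIntegral.intervalIntegrable_rpow' (a := 0) (b := 1)
        (by linarith : -1 < -p)).const_mul u
      rwa [intervalIntegrable_iff_integrableOn_Ioc_of_le zero_le_one] at this
    refine h1.mono' hmeas.aestronglyMeasurable ?_
    filter_upwards [ae_restrict_mem measurableSet_Ioc] with s hs
    have hs0 : 0 < s := hs.1
    have hle : Real.exp (-(s * u)) ≤ 1 := Real.exp_le_one_iff.2 (by nlinarith)
    have hge := Real.add_one_le_exp (-(s * u))
    have hr : 0 ≤ s ^ (-1 - p) := by positivity
    rw [Real.norm_of_nonneg (mul_nonneg (by linarith) hr)]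
    have : s ^ (-p) = s * s ^ (-1 - p) := by
      rw [← Real.rpow_one_add' hs0.le (by linarith)]; congr 1; ring
    rw [this]
    nlinarith
  · have h1 : IntegrableOn (fun s : ℝ => s ^ (-1 - p)) (Set.Ioi 1) :=
      integrableOn_Ioi_rpow_of_lt (by linarith) zero_lt_one
    refine h1.mono' hmeas.aestronglyMeasurable ?_
    filter_upwards [ae_restrict_mem measurableSet_Ioi] with s hs
    have hs0 : 0 < s := zero_lt_one.trans hs
    have hle : Real.exp (-(s * u)) ≤ 1 := Real.exp_le_one_iff.2 (by nlinarith)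
    have hge := Real.exp_pos (-(s * u))
    have hr : 0 ≤ s ^ (-1 - p) := by positivity
    rw [Real.norm_of_nonneg (mul_nonneg (by linarith) hr)]
    nlinarith

/-- Up to a positive constant, `u ^ p` is a mixture of the functions `1 - exp (- s u)`. -/
theorem exists_rpow_eq_integral {p : ℝ} (hp0 : 0 < p) (hp1 : p < 1) :
    ∃ K : ℝ, 0 < K ∧ ∀ u : ℝ, 0 ≤ u →
      u ^ p = K * ∫ s in Set.Ioi (0 : ℝ), (1 - Real.exp (-(s * u))) * s ^ (-1 - p) := by
  set c := ∫ s in Set.Ioi (0 : ℝ), (1 - Real.exp (-(s * 1))) * s ^ (-1 - p) with hc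
  have hcpos : 0 < c := by
    rw [hc, setIntegral_pos_iff_support_of_nonneg_ae]
    · refine lt_of_lt_of_le ?_ (measure_mono (s := Set.Ioi (0 : ℝ)) ?_)
      · simp
      · intro s hs
        have hs0 : 0 < s := hs
        refine ⟨?_, hs⟩
        have : Real.exp (-(s * 1)) < 1 := Real.exp_lt_one_iff.2 (by linarith)
        exact (mul_pos (by linarith) (by positivity)).ne'
    · filter_upwards [ae_restrict_mem measurableSet_Ioi] with s hs
      have hs0 : 0 < s := hs
      have : Real.exp (-(s * 1)) < 1 := Real.exp_lt_one_iff.2 (by linarith)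
      exact (mul_pos (by linarith) (by positivity)).le
    · exact integrableOn_one_sub_exp_mul_rpow hp0 hp1 zero_le_one
  -- The substitution `s ↦ u * s` reduces every `u > 0` to `u = 1`, at the cost of a factor `u ^ p`.
  refine ⟨c⁻¹, inv_pos.2 hcpos, fun u hu => ?_⟩
  rcases hu.eq_or_lt with rfl | hu
  · simp [hp0.ne']
  have h := integral_comp_mul_left_Ioi
    (fun s : ℝ => (1 - Real.exp (-(s * 1))) * s ^ (-1 - p)) 0 hu
  rw [mul_zero, ← hc, smul_eq_mul] at h
  have h2 : ∫ s in Set.Ioi (0 : ℝ), (1 - Real.exp (-(s * u))) * s ^ (-1 - p) =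
      u ^ (1 + p) * (u⁻¹ * c) := by
    rw [← h, ← integral_const_mul]
    refine setIntegral_congr_fun measurableSet_Ioi fun s hs => ?_
    have hs0 : (0 : ℝ) < s := hs
    rw [Real.mul_rpow hu.le hs0.le, show u * s * 1 = s * u by ring,
      show (-1 - p : ℝ) = -(1 + p) by ring, Real.rpow_neg hu.le]
    have : u ^ (1 + p) ≠ 0 := by positivity
    field_simp
  rw [h2, Real.rpow_add hu, Real.rpow_one]
  field_simp

/-! ### Squared Fourier transforms of weighted points -/

section FourierSq

variable {V : Type*} [NormedAddCommGroup V] [InnerProductSpace ℝ V] {ι : Type*} [Fintype ι]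

/-- The squared modulus of the Fourier transform `∑ p, w p * exp (i ⟪x p, t⟫)`. -/
def fourierSq (w : ι → ℝ) (x : ι → V) (t : V) : ℝ :=
  (∑ p, w p * Real.cos (inner ℝ (x p) t)) ^ 2 + (∑ p, w p * Real.sin (inner ℝ (x p) t)) ^ 2

theorem fourierSq_nonneg (w : ι → ℝ) (x : ι → V) (t : V) : 0 ≤ fourierSq w x t := by
  unfold fourierSq; positivity

theorem fourierSq_eq_sum (w : ι → ℝ) (x : ι → V) (t : V) :
    fourierSq w x t = ∑ p, ∑ r, w p * w r * Real.cos (inner ℝ (x p - x r) t) := by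
  simp only [fourierSq, sq, Finset.sum_mul_sum, ← Finset.sum_add_distrib, inner_sub_left,
    Real.cos_sub]
  refine Finset.sum_congr rfl fun p _ => Finset.sum_congr rfl fun r _ => ?_
  ring

@[fun_prop]
theorem continuous_fourierSq (w : ι → ℝ) (x : ι → V) : Continuous (fourierSq w x) := by
  unfold fourierSq; fun_prop

theorem fourierSq_le (w : ι → ℝ) (x : ι → V) (t : V) :
    fourierSq w x t ≤ ∑ p, ∑ r, |w p * w r| := by
  rw [fourierSq_eq_sum]
  refine Finset.sum_le_sum fun p _ => Finset.sum_le_sum fun r _ => ?_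
  refine (le_abs_self _).trans ?_
  rw [abs_mul]
  exact mul_le_of_le_one_right (abs_nonneg _) (Real.abs_cos_le_one _)

end FourierSq

/-! ### Gaussian kernels and negative definiteness -/

section Fourier

variable {V : Type*} [NormedAddCommGroup V] [InnerProductSpace ℝ V] [FiniteDimensional ℝ V]
  [MeasurableSpace V] [BorelSpace V] {ι : Type*} [Fintype ι]

theorem integrable_exp_neg_mul_sq_norm {b : ℝ} (hb : 0 < b) :
    Integrable fun t : V => Real.exp (-b * ‖t‖ ^ 2) := by
  have h := (GaussianFourier.integrable_cexp_neg_mul_sq_norm_add (V := V) (b := (b : ℂ))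
    (by simpa using hb) 0 0).norm
  refine h.congr (ae_of_all _ fun t => ?_)
  simp only [Complex.norm_exp]
  congr 1
  simp [← Complex.ofReal_pow]

theorem integral_cos_inner_mul_exp {b : ℝ} (hb : 0 < b) (x : V) :
    ∫ t : V, Real.cos (inner ℝ x t) * Real.exp (-b * ‖t‖ ^ 2) =
      (Real.pi / b) ^ ((Module.finrank ℝ V : ℝ) / 2) * Real.exp (-‖x‖ ^ 2 / (4 * b)) := by
  have hb' : 0 < (b : ℂ).re := by simpa using hb
  have h := GaussianFourier.integral_cexp_neg_mul_sq_norm_add (V := V) hb' Complex.I x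
  have hi := GaussianFourier.integrable_cexp_neg_mul_sq_norm_add (V := V) hb' Complex.I x
  have h1 := congrArg Complex.re h
  rw [← Complex.reCLM_apply, ← ContinuousLinearMap.integral_comp_comm _ hi] at h1
  have hl : ∀ t : V, Complex.reCLM (Complex.exp (-(b : ℂ) * ‖t‖ ^ 2 + Complex.I * (inner ℝ x t : ℝ)))
      = Real.cos (inner ℝ x t) * Real.exp (-b * ‖t‖ ^ 2) := by
    intro t
    rw [Complex.reCLM_apply, Complex.exp_re]
    simp [← Complex.ofReal_pow, mul_comm]
  simp only [hl] at h1
  rw [h1]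
  have hr : ((Real.pi : ℂ) / b) ^ ((Module.finrank ℝ V : ℂ) / 2) *
      Complex.exp (Complex.I ^ 2 * ‖x‖ ^ 2 / (4 * b)) =
      (((Real.pi / b) ^ ((Module.finrank ℝ V : ℝ) / 2) * Real.exp (-‖x‖ ^ 2 / (4 * b)) : ℝ) : ℂ) := by
    rw [Complex.ofReal_mul, Complex.ofReal_cpow (by positivity)]
    push_cast
    simp
  rw [hr, Complex.ofReal_re]

variable (V) in
/-- The measure with density `exp (- ‖t‖ ^ 2 / 4)`. -/
def gaussWeight : Measure V :=
  volume.withDensity fun t => ENNReal.ofReal (Real.exp (-(1 / 4) * ‖t‖ ^ 2))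

instance : IsFiniteMeasure (gaussWeight V) :=
  isFiniteMeasure_withDensity_ofReal (integrable_exp_neg_mul_sq_norm (by norm_num)).2

theorem integral_gaussWeight (f : V → ℝ) :
    ∫ t, f t ∂gaussWeight V = ∫ t, f t * Real.exp (-(1 / 4) * ‖t‖ ^ 2) := by
  rw [gaussWeight, integral_withDensity_eq_integral_toReal_smul (by fun_prop)
    (ae_of_all _ fun _ => ENNReal.ofReal_lt_top)]
  refine integral_congr_ae (ae_of_all _ fun t => ?_)
  simp [ENNReal.toReal_ofReal (Real.exp_pos _).le, mul_comm]

/-- Positive definiteness of the Gaussian kernel in explicit form: each kernel value is a Gaussian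
integral of cosines, and the double sum of cosines is a squared modulus. -/
theorem sum_mul_exp_eq_integral_fourierSq {b : ℝ} (hb : 0 < b) (w : ι → ℝ) (x : ι → V) :
    ∑ p, ∑ r, w p * w r * Real.exp (-‖x p - x r‖ ^ 2 / (4 * b)) =
      (b / Real.pi) ^ ((Module.finrank ℝ V : ℝ) / 2) *
        ∫ t, fourierSq w x t * Real.exp (-b * ‖t‖ ^ 2) := by
  have hint : ∀ y : V, Integrable fun t : V =>
      Real.cos (inner ℝ y t) * Real.exp (-b * ‖t‖ ^ 2) := fun y =>
    (integrable_exp_neg_mul_sq_norm hb).bdd_mul (c := 1) (by fun_prop)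
      (ae_of_all _ fun t => by simpa using Real.abs_cos_le_one _)
  have : ∫ t, fourierSq w x t * Real.exp (-b * ‖t‖ ^ 2) =
      ∑ p, ∑ r, w p * w r * ((Real.pi / b) ^ ((Module.finrank ℝ V : ℝ) / 2) *
        Real.exp (-‖x p - x r‖ ^ 2 / (4 * b))) := by
    simp only [fourierSq_eq_sum, Finset.sum_mul, mul_assoc]
    rw [integral_finsetSum _ fun p _ => integrable_finsetSum _ fun r _ =>
      ((hint _).const_mul _).const_mul _]
    refine Finset.sum_congr rfl fun p _ => ?_
    rw [integral_finsetSum _ fun r _ => ((hint _).const_mul _).const_mul _]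
    refine Finset.sum_congr rfl fun r _ => ?_
    rw [integral_const_mul, integral_const_mul, integral_cos_inner_mul_exp hb]
  rw [this, Finset.mul_sum]
  refine Finset.sum_congr rfl fun p _ => ?_
  rw [Finset.mul_sum]
  refine Finset.sum_congr rfl fun r _ => ?_
  have hinv : (b / Real.pi) ^ ((Module.finrank ℝ V : ℝ) / 2) *
      (Real.pi / b) ^ ((Module.finrank ℝ V : ℝ) / 2) = 1 := by
    rw [← Real.mul_rpow (by positivity) (by positivity),
      show b / Real.pi * (Real.pi / b) = 1 by field_simp, Real.one_rpow]
  linear_combination (- w p * w r * Real.exp (-‖x p - x r‖ ^ 2 / (4 * b))) * hinv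

theorem integrable_fourierSq_mul_exp {b : ℝ} (hb : 0 < b) (w : ι → ℝ) (x : ι → V) :
    Integrable fun t => fourierSq w x t * Real.exp (-b * ‖t‖ ^ 2) :=
  (integrable_exp_neg_mul_sq_norm hb).bdd_mul (by fun_prop) (ae_of_all _ fun t => by
    rw [Real.norm_of_nonneg (fourierSq_nonneg w x t)]; exact fourierSq_le w x t)

theorem sum_mul_exp_nonneg {s : ℝ} (hs : 0 < s) (w : ι → ℝ) (x : ι → V) :
    0 ≤ ∑ p, ∑ r, w p * w r * Real.exp (-(s * ‖x p - x r‖ ^ 2)) := by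
  have hb : 0 < 1 / (4 * s) := by positivity
  have h := sum_mul_exp_eq_integral_fourierSq hb w x
  have he : ∀ y : ℝ, -y / (4 * (1 / (4 * s))) = -(s * y) := fun y => by field_simp
  simp only [he] at h
  rw [h]
  exact mul_nonneg (by positivity) (integral_nonneg fun t =>
    mul_nonneg (fourierSq_nonneg w x t) (Real.exp_pos _).le)

/-- For such `s`, the frequency parameter `b = 1 / (4 s)` lies in `[1/8, 1/4]`: the lower end bounds
the normalising constant, the upper end the Gaussian density. This gives one weight for all these
`s`. -/
theorem mul_integral_fourierSq_le_sum_mul_exp {s : ℝ} (hs1 : 1 ≤ s) (hs2 : s ≤ 2)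
    (w : ι → ℝ) (x : ι → V) :
    (1 / (8 * Real.pi)) ^ ((Module.finrank ℝ V : ℝ) / 2) * ∫ t, fourierSq w x t ∂gaussWeight V ≤
      ∑ p, ∑ r, w p * w r * Real.exp (-(s * ‖x p - x r‖ ^ 2)) := by
  have hs : 0 < s := by linarith
  have hb : 0 < 1 / (4 * s) := by positivity
  have h := sum_mul_exp_eq_integral_fourierSq hb w x
  have he : ∀ y : ℝ, -y / (4 * (1 / (4 * s))) = -(s * y) := fun y => by field_simp
  simp only [he] at h
  rw [h, integral_gaussWeight]
  refine mul_le_mul ?_ ?_ (integral_nonneg fun t =>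
    mul_nonneg (fourierSq_nonneg w x t) (Real.exp_pos _).le) (by positivity)
  · refine Real.rpow_le_rpow (by positivity) ?_ (by positivity)
    rw [div_div]
    have := Real.pi_pos
    exact one_div_le_one_div_of_le (by positivity) (by nlinarith)
  · refine integral_mono (integrable_fourierSq_mul_exp (by norm_num) w x)
      (integrable_fourierSq_mul_exp hb w x) fun t => ?_
    refine mul_le_mul_of_nonneg_left (Real.exp_le_exp.2 ?_) (fourierSq_nonneg w x t)
    have : 1 / (4 * s) ≤ 1 / 4 := one_div_le_one_div_of_le (by norm_num) (by linarith)
    nlinarith [sq_nonneg ‖t‖]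

variable (V) in
/-- A quantitative form of the negative definiteness of the kernel `‖x - y‖ ^ α`. -/
theorem exists_mul_integral_fourierSq_le {α : ℝ} (h0 : 0 < α) (h2 : α < 2) :
    ∃ c : ℝ, 0 < c ∧ ∀ {ι : Type} [Fintype ι] (w : ι → ℝ) (x : ι → V), ∑ p, w p = 0 →
      c * ∫ t, fourierSq w x t ∂gaussWeight V ≤ -∑ p, ∑ r, w p * w r * ‖x p - x r‖ ^ α := by
  have hp0 : 0 < α / 2 := by linarith
  have hp1 : α / 2 < 1 := by linarith
  obtain ⟨K, hK, hKu⟩ := exists_rpow_eq_integral hp0 hp1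
  have hrpow : ∀ y : V, ‖y‖ ^ α = K * ∫ s in Set.Ioi (0 : ℝ),
      (1 - Real.exp (-(s * ‖y‖ ^ 2))) * s ^ (-1 - α / 2) := fun y => by
    rw [← hKu _ (sq_nonneg _), ← Real.rpow_natCast_mul (norm_nonneg y)]
    congr 1; push_cast; ring
  set d : ℝ := (1 / (8 * Real.pi)) ^ ((Module.finrank ℝ V : ℝ) / 2) with hd
  have hdpos : 0 < d := by have := Real.pi_pos; positivity
  -- The last factor is the minimum of `s ^ (-1 - α / 2)` on `(1, 2]`, the only range of `s` that is
  -- kept.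
  refine ⟨K * (d * 2 ^ (-1 - α / 2)), by positivity, fun {ι} _ w x hw => ?_⟩
  set Q : ℝ → ℝ := fun s => ∑ p, ∑ r, w p * w r * Real.exp (-(s * ‖x p - x r‖ ^ 2)) with hQ
  set I := ∫ t, fourierSq w x t ∂gaussWeight V with hI
  have hI0 : 0 ≤ I := integral_nonneg fun t => fourierSq_nonneg w x t
  -- Zero total weight cancels the constant `1` in `1 - exp`, leaving minus the Gaussian form `Q`.
  have hww : ∑ p, ∑ r, w p * w r = 0 := by rw [← Finset.sum_mul_sum, hw, zero_mul]
  have hQeq : ∀ s, Q s * s ^ (-1 - α / 2) =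
      -∑ p, ∑ r, w p * w r * ((1 - Real.exp (-(s * ‖x p - x r‖ ^ 2))) * s ^ (-1 - α / 2)) := by
    intro s
    have : ∑ p, ∑ r, w p * w r * ((1 - Real.exp (-(s * ‖x p - x r‖ ^ 2))) * s ^ (-1 - α / 2)) =
        (∑ p, ∑ r, w p * w r) * s ^ (-1 - α / 2) - Q s * s ^ (-1 - α / 2) := by
      simp only [hQ, Finset.sum_mul, ← Finset.sum_sub_distrib]
      refine Finset.sum_congr rfl fun p _ => Finset.sum_congr rfl fun r _ => ?_
      ring
    rw [this, hww]; ring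
  have hint : ∀ p r, IntegrableOn (fun s : ℝ =>
      w p * w r * ((1 - Real.exp (-(s * ‖x p - x r‖ ^ 2))) * s ^ (-1 - α / 2))) (Set.Ioi 0) :=
    fun p r => (integrableOn_one_sub_exp_mul_rpow hp0 hp1 (sq_nonneg _)).const_mul _
  have hQint : IntegrableOn (fun s => Q s * s ^ (-1 - α / 2)) (Set.Ioi 0) := by
    simp only [hQeq]
    exact (integrable_finsetSum _ fun p _ => integrable_finsetSum _ fun r _ => hint p r).neg
  have hsum : -∑ p, ∑ r, w p * w r * ‖x p - x r‖ ^ α =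
      K * ∫ s in Set.Ioi (0 : ℝ), Q s * s ^ (-1 - α / 2) := by
    simp only [hQeq]
    rw [integral_neg, integral_finsetSum _ fun p _ => integrable_finsetSum _ fun r _ => hint p r,
      mul_neg, Finset.mul_sum]
    congr 1
    refine Finset.sum_congr rfl fun p _ => ?_
    rw [integral_finsetSum _ fun r _ => hint p r, Finset.mul_sum]
    refine Finset.sum_congr rfl fun r _ => ?_
    rw [integral_const_mul, hrpow]
    ring
  rw [hsum, mul_assoc]
  refine mul_le_mul_of_nonneg_left ?_ hK.le
  have hsub : Set.Ioc (1 : ℝ) 2 ⊆ Set.Ioi 0 := fun s hs => zero_lt_one.trans hs.1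
  calc d * 2 ^ (-1 - α / 2) * I
      = ∫ _ in Set.Ioc (1 : ℝ) 2, d * I * 2 ^ (-1 - α / 2) := by
        rw [setIntegral_const]; simp; norm_num; ring
    _ ≤ ∫ s in Set.Ioc (1 : ℝ) 2, Q s * s ^ (-1 - α / 2) := by
        refine setIntegral_mono_on (integrableOn_const (by simp)) (hQint.mono_set hsub) measurableSet_Ioc
          fun s hs => ?_
        have hs0 : 0 < s := zero_lt_one.trans hs.1
        refine mul_le_mul (mul_integral_fourierSq_le_sum_mul_exp hs.1.le hs.2 w x) ?_
          (by positivity) (sum_mul_exp_nonneg hs0 w x)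
        exact Real.rpow_le_rpow_of_nonpos hs0 hs.2 (by linarith)
    _ ≤ ∫ s in Set.Ioi (0 : ℝ), Q s * s ^ (-1 - α / 2) := by
        refine setIntegral_mono_set hQint ?_ hsub.eventuallyLE
        filter_upwards [ae_restrict_mem measurableSet_Ioi] with s hs
        have hs0 : 0 < s := hs
        exact mul_nonneg (sum_mul_exp_nonneg hs0 w x) (by positivity)

end Fourier

/-! ### Decomposition of the total dispersion -/

section Algebra

theorem meanDist_self_nonneg {q : ℕ} {ι : Type} [Fintype ι] (α : ℝ)
    (A : ι → EuclideanSpace ℝ (Fin q)) : 0 ≤ meanDist α A A := by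
  unfold meanDist; positivity

theorem meanDist_comm {q : ℕ} {ι κ : Type} [Fintype ι] [Fintype κ] (α : ℝ)
    (A : ι → EuclideanSpace ℝ (Fin q)) (B : κ → EuclideanSpace ℝ (Fin q)) :
    meanDist α A B = meanDist α B A := by
  unfold meanDist
  rw [Finset.sum_comm, mul_comm (Fintype.card ι : ℝ)]
  simp only [norm_sub_rev]

theorem energyDist_comm {q n m : ℕ} (α : ℝ)
    (A : Fin n → EuclideanSpace ℝ (Fin q)) (B : Fin m → EuclideanSpace ℝ (Fin q)) :
    energyDist α A B = energyDist α B A := by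
  unfold energyDist
  rw [meanDist_comm α A B, mul_comm (n : ℝ), add_comm (n : ℝ)]
  ring

theorem energyDist_self {q n : ℕ} (α : ℝ) (A : Fin n → EuclideanSpace ℝ (Fin q)) :
    energyDist α A A = 0 := by
  unfold energyDist; ring

theorem two_mul_sum_ite_lt {n : ℕ} (f : Fin n → Fin n → ℝ) (hs : ∀ i j, f i j = f j i)
    (hd : ∀ i, f i i = 0) : 2 * ∑ i, ∑ j, (if i < j then f i j else 0) = ∑ i, ∑ j, f i j := by
  have hcomm : ∑ i, ∑ j, (if i < j then f i j else 0) =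
      ∑ i, ∑ j, (if j < i then f i j else 0) := by
    rw [Finset.sum_comm]
    refine Finset.sum_congr rfl fun i _ => Finset.sum_congr rfl fun j _ => ?_
    rw [hs]
  rw [two_mul]
  nth_rewrite 2 [hcomm]
  simp only [← Finset.sum_add_distrib]
  refine Finset.sum_congr rfl fun i _ => Finset.sum_congr rfl fun j _ => ?_
  rcases lt_trichotomy i j with h | rfl | h
  · simp [h, h.not_gt]
  · simp [hd]
  · simp [h, h.not_gt]

variable {q k : ℕ} {n : Fin (k + 1) → ℕ}

theorem two_mul_multiEnergyDist (α : ℝ) (U : Samples q n) :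
    2 * multiEnergyDist α U = ∑ i, ∑ j,
      ((n i : ℝ) + (n j : ℝ)) / (2 * (totalSize n : ℝ)) * energyDist α (U i) (U j) :=
  two_mul_sum_ite_lt _ (fun i j => by rw [energyDist_comm, add_comm (n i : ℝ)])
    (fun i => by rw [energyDist_self, mul_zero])

theorem totalSize_pos (hn : ∀ j, 0 < n j) : 0 < totalSize n :=
  Finset.sum_pos (fun j _ => hn j) Finset.univ_nonempty

theorem totalDispersion_eq_sum (hn : ∀ j, 0 < n j) (α : ℝ) (U : Samples q n) :
    totalDispersion α U = 1 / (2 * (totalSize n : ℝ)) *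
      ∑ p : (Σ j, Fin (n j)), ∑ r, ‖pooled U p - pooled U r‖ ^ α := by
  have hT : (totalSize n : ℝ) ≠ 0 := by exact_mod_cast (totalSize_pos hn).ne'
  have hc : (Fintype.card (Σ j, Fin (n j)) : ℝ) = totalSize n := by simp [totalSize]
  unfold totalDispersion meanDist
  rw [hc]
  field_simp

/-- After cancelling `n i + n j`, the pair `(i, j)` contributes `n i * n j * (2 * m i j - m i i - m
j j)` up to the factor `1 / (2T)`. The mixed terms add up to the pooled double sum; since the sizes
sum to `T`, the diagonal terms give the within-sample dispersion. -/
theorem totalDispersion_eq_add (hn : ∀ j, 0 < n j) (α : ℝ) (U : Samples q n) :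
    totalDispersion α U = multiEnergyDist α U + withinDispersion α U := by
  have hT : (totalSize n : ℝ) ≠ 0 := by exact_mod_cast (totalSize_pos hn).ne'
  have hn' : ∀ j, (n j : ℝ) ≠ 0 := fun j => by exact_mod_cast (hn j).ne'
  have hsum : ∑ j, (n j : ℝ) = totalSize n := by simp [totalSize]
  set m : Fin (k + 1) → Fin (k + 1) → ℝ := fun i j => meanDist α (U i) (U j) with hm
  have h1 : 2 * (totalSize n : ℝ) * totalDispersion α U = ∑ i, ∑ j, (n i : ℝ) * n j * m i j := by
    rw [totalDispersion_eq_sum hn, ← mul_assoc, mul_one_div_cancel (by simpa using hT), one_mul,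
      Fintype.sum_sigma]
    refine Finset.sum_congr rfl fun i _ => ?_
    simp only [Fintype.sum_sigma]
    rw [Finset.sum_comm]
    refine Finset.sum_congr rfl fun j _ => ?_
    simp only [hm, meanDist, Fintype.card_fin, pooled]
    have := hn' i; have := hn' j
    field_simp
  have h2 : 2 * (totalSize n : ℝ) * (2 * multiEnergyDist α U) =
      ∑ i, ∑ j, (n i : ℝ) * n j * (2 * m i j - m i i - m j j) := by
    rw [two_mul_multiEnergyDist]
    simp only [Finset.mul_sum]
    refine Finset.sum_congr rfl fun i _ => Finset.sum_congr rfl fun j _ => ?_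
    have : (n i : ℝ) + n j ≠ 0 := by have := hn i; positivity
    simp only [energyDist, hm]
    field_simp
  have h3 : ∑ i, ∑ j, (n i : ℝ) * n j * (2 * m i j - m i i - m j j) =
      2 * (∑ i, ∑ j, (n i : ℝ) * n j * m i j) - 2 * (totalSize n * ∑ i, n i * m i i) := by
    have ha : ∑ i, ∑ j, (n i : ℝ) * n j * m i i = totalSize n * ∑ i, n i * m i i := by
      rw [← hsum, mul_comm, Finset.sum_mul_sum]
      exact Finset.sum_congr rfl fun i _ => Finset.sum_congr rfl fun j _ => by ring
    have hb : ∑ i, ∑ j, (n i : ℝ) * n j * m j j = totalSize n * ∑ i, n i * m i i := by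
      rw [← hsum, Finset.sum_mul_sum]
      exact Finset.sum_congr rfl fun i _ => Finset.sum_congr rfl fun j _ => by ring
    have : ∀ i j, (n i : ℝ) * n j * (2 * m i j - m i i - m j j) =
      2 * ((n i : ℝ) * n j * m i j) - (n i : ℝ) * n j * m i i - (n i : ℝ) * n j * m j j :=
      fun i j => by ring
    simp only [this, Finset.sum_sub_distrib, ← Finset.mul_sum, ha, hb]
    ring
  have h4 : 2 * withinDispersion α U = ∑ i, n i * m i i := by
    rw [withinDispersion, Finset.mul_sum]
    exact Finset.sum_congr rfl fun i _ => by simp only [hm]; ring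
  have : (2 * (totalSize n : ℝ) * 2) * totalDispersion α U =
      (2 * (totalSize n : ℝ) * 2) * (multiEnergyDist α U + withinDispersion α U) := by
    rw [h3, ← h1, ← h4] at h2
    linear_combination (-1) * h2
  exact mul_left_cancel₀ (by simpa using hT) this

theorem withinDispersion_nonneg (α : ℝ) (U : Samples q n) : 0 ≤ withinDispersion α U :=
  Finset.sum_nonneg fun j _ => mul_nonneg (by positivity) (meanDist_self_nonneg α _)

theorem totalDispersion_nonneg (α : ℝ) (U : Samples q n) : 0 ≤ totalDispersion α U :=
  mul_nonneg (by positivity) (meanDist_self_nonneg α _)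

end Algebra

/-! ### Measurability of the statistics -/

section Measurability

theorem measurable_meanDist {q : ℕ} {ι κ Ω : Type} [Fintype ι] [Fintype κ] [MeasurableSpace Ω]
    (α : ℝ) {A : Ω → ι → EuclideanSpace ℝ (Fin q)} {B : Ω → κ → EuclideanSpace ℝ (Fin q)}
    (hA : Measurable A) (hB : Measurable B) : Measurable fun ω => meanDist α (A ω) (B ω) := by
  unfold meanDist
  fun_prop

variable {q k : ℕ} {n : Fin (k + 1) → ℕ}

theorem measurable_withinDispersion (α : ℝ) :
    Measurable fun U : Samples q n => withinDispersion α U := by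
  unfold withinDispersion
  exact Finset.measurable_sum _ fun j _ => (measurable_meanDist α (by fun_prop)
    (by fun_prop)).const_mul _

theorem measurable_totalDispersion (α : ℝ) :
    Measurable fun U : Samples q n => totalDispersion α U := by
  have h : Measurable fun U : Samples q n => pooled U :=
    measurable_pi_lambda _ fun p => by unfold pooled; fun_prop
  exact (measurable_meanDist α h h).const_mul _

theorem measurable_multiEnergyDist (hn : ∀ j, 0 < n j) (α : ℝ) :
    Measurable fun U : Samples q n => multiEnergyDist α U := by
  have : (fun U : Samples q n => multiEnergyDist α U) =
      fun U => totalDispersion α U - withinDispersion α U := by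
    funext U; rw [totalDispersion_eq_add hn]; ring
  rw [this]
  exact (measurable_totalDispersion α).sub (measurable_withinDispersion α)

end Measurability

/-! ### Energy distance bounded below by empirical characteristic functions -/

section LowerBound

/-- The mean of `f` over a finite sample. -/
def sampleMean {V : Type*} {n : ℕ} (f : V → ℝ) (A : Fin n → V) : ℝ := (n : ℝ)⁻¹ * ∑ i, f (A i)

/-- The squared distance between the empirical characteristic functions of two samples. -/
def empFourierDist {V : Type*} [NormedAddCommGroup V] [InnerProductSpace ℝ V] {n m : ℕ}
    (A : Fin n → V) (B : Fin m → V) (t : V) : ℝ :=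
  (sampleMean (fun x => Real.cos (inner ℝ x t)) A -
    sampleMean (fun x => Real.cos (inner ℝ x t)) B) ^ 2 +
  (sampleMean (fun x => Real.sin (inner ℝ x t)) A -
    sampleMean (fun x => Real.sin (inner ℝ x t)) B) ^ 2

theorem empFourierDist_nonneg {V : Type*} [NormedAddCommGroup V] [InnerProductSpace ℝ V] {n m : ℕ}
    (A : Fin n → V) (B : Fin m → V) (t : V) : 0 ≤ empFourierDist A B t := by
  unfold empFourierDist; positivity

/-- Negative definiteness applied to masses `1 / n` on `A` and `-1 / m` on `B`, whose total is zero.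
It matters later that `c` does not depend on the sample sizes. -/
theorem exists_mul_integral_empFourierDist_le (q : ℕ) {α : ℝ} (h0 : 0 < α) (h2 : α < 2) :
    ∃ c : ℝ, 0 < c ∧ ∀ (n m : ℕ) (A : Fin n → EuclideanSpace ℝ (Fin q))
      (B : Fin m → EuclideanSpace ℝ (Fin q)), 0 < n → 0 < m →
      c * ∫ t, empFourierDist A B t ∂gaussWeight (EuclideanSpace ℝ (Fin q)) ≤
        2 * meanDist α A B - meanDist α A A - meanDist α B B := by
  obtain ⟨c, hc, h⟩ := exists_mul_integral_fourierSq_le (EuclideanSpace ℝ (Fin q)) h0 h2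
  refine ⟨c, hc, fun n m A B hn hm => ?_⟩
  have hn' : (n : ℝ) ≠ 0 := by exact_mod_cast hn.ne'
  have hm' : (m : ℝ) ≠ 0 := by exact_mod_cast hm.ne'
  have key := h (Sum.elim (fun _ : Fin n => (n : ℝ)⁻¹) (fun _ : Fin m => -(m : ℝ)⁻¹))
    (Sum.elim A B) (by simp [hn', hm'])
  have hL : fourierSq (Sum.elim (fun _ : Fin n => (n : ℝ)⁻¹) (fun _ : Fin m => -(m : ℝ)⁻¹))
      (Sum.elim A B) = empFourierDist A B := by
    funext t
    simp only [fourierSq, empFourierDist, sampleMean, Fintype.sum_sum_type, Sum.elim_inl,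
      Sum.elim_inr, Finset.mul_sum, neg_mul, Finset.sum_neg_distrib, sub_eq_add_neg]
  rw [hL] at key
  refine key.trans (le_of_eq ?_)
  rw [show 2 * meanDist α A B = meanDist α A B + meanDist α B A by rw [meanDist_comm α B A]; ring]
  simp only [meanDist, Fintype.sum_sum_type, Sum.elim_inl, Sum.elim_inr, Finset.sum_add_distrib,
    ← Finset.mul_sum, Fintype.card_fin]
  field_simp
  ring

theorem energyDist_nonneg {q n m : ℕ} {α : ℝ} (h0 : 0 < α) (h2 : α < 2) (hn : 0 < n) (hm : 0 < m)
    (A : Fin n → EuclideanSpace ℝ (Fin q)) (B : Fin m → EuclideanSpace ℝ (Fin q)) :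
    0 ≤ energyDist α A B := by
  obtain ⟨c, hc, h⟩ := exists_mul_integral_empFourierDist_le q h0 h2
  refine mul_nonneg (by positivity) (le_trans ?_ (h n m A B hn hm))
  exact mul_nonneg hc.le (integral_nonneg fun t => empFourierDist_nonneg A B t)

variable {q k : ℕ} {n : Fin (k + 1) → ℕ}

theorem multiEnergyDist_nonneg {α : ℝ} (h0 : 0 < α) (h2 : α < 2) (hn : ∀ j, 0 < n j)
    (U : Samples q n) : 0 ≤ multiEnergyDist α U := by
  refine Finset.sum_nonneg fun i _ => Finset.sum_nonneg fun j _ => ?_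
  split_ifs
  · exact mul_nonneg (by positivity) (energyDist_nonneg h0 h2 (hn i) (hn j) _ _)
  · exact le_rfl

theorem mul_energyDist_le_multiEnergyDist {α : ℝ} (h0 : 0 < α) (h2 : α < 2) (hn : ∀ j, 0 < n j)
    (U : Samples q n) {i j : Fin (k + 1)} (hij : i ≠ j) :
    ((n i : ℝ) + n j) / (2 * totalSize n) * energyDist α (U i) (U j) ≤ multiEnergyDist α U := by
  wlog hlt : i < j generalizing i j
  · rw [energyDist_comm, add_comm (n i : ℝ)]
    exact this hij.symm (lt_of_le_of_ne (not_lt.1 hlt) hij.symm)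
  have hnn : ∀ i j, 0 ≤ if i < j then ((n i : ℝ) + n j) / (2 * totalSize n) *
      energyDist α (U i) (U j) else 0 := by
    intro i j
    split_ifs
    · exact mul_nonneg (by positivity) (energyDist_nonneg h0 h2 (hn i) (hn j) _ _)
    · exact le_rfl
  refine le_trans ?_ (Finset.single_le_sum (fun i _ => Finset.sum_nonneg fun j _ => hnn i j)
    (Finset.mem_univ i))
  refine le_trans ?_ (Finset.single_le_sum (fun j _ => hnn i j) (Finset.mem_univ j))
  rw [if_pos hlt]

end LowerBound

/-! ### The level of the test -/

section Level

variable {q k : ℕ}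

/-- Along admissible thresholds decreasing to the infimum, the rejection events increase to the
event of exceeding the infimum, so the bound `a` passes to the limit. -/
theorem rejectionProb_criticalValue_le (α : ℝ) (n : Fin (k + 1) → ℕ) (a : ℝ)
    (G : Measure (EuclideanSpace ℝ (Fin q))) (hG : IsProbabilityMeasure G) :
    rejectionProb α n (criticalValue q α n a) (fun _ => G) ≤ ENNReal.ofReal a := by
  set s : Set ℝ≥0∞ := {c | ∀ G : Measure (EuclideanSpace ℝ (Fin q)), IsProbabilityMeasure G →
    rejectionProb α n c (fun _ => G) ≤ ENNReal.ofReal a} with hs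
  have hne : s.Nonempty := ⟨∞, fun G _ => by simp [rejectionProb]⟩
  obtain ⟨u, hu, htend, hmem⟩ := exists_seq_tendsto_sInf hne (OrderBot.bddBelow s)
  have hset : {U : Samples q n | criticalValue q α n a < ratioStat α U} =
      ⋃ m, {U | u m < ratioStat α U} := by
    ext U
    simp only [Set.mem_ofPred_eq, Set.mem_iUnion]
    constructor
    · intro h
      exact (htend.eventually_lt_const h).exists
    · rintro ⟨m, hm⟩
      exact lt_of_le_of_lt (sInf_le (hmem m)) hm
  rw [rejectionProb, hset, Monotone.measure_iUnion]
  · exact iSup_le fun m => hmem m G hG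
  · intro m m' hmm U hU
    exact lt_of_le_of_lt (hu hmm) hU

end Level

/-! ### Exchangeability of the pooled sample -/

section Exchangeability

/-- One swap sends `p` to `p'`; a second one corrects the image of `r` and fixes `p'`, which differs
both from that image and from `r'`. -/
theorem exists_perm_apply_eq_apply_eq {ι : Type*} [DecidableEq ι] {p r p' r' : ι} (h : p ≠ r)
    (h' : p' ≠ r') : ∃ σ : Equiv.Perm ι, σ p = p' ∧ σ r = r' := by
  refine ⟨(Equiv.swap p p').trans (Equiv.swap (Equiv.swap p p' r) r'), ?_, by simp⟩
  have h1 : p' ≠ Equiv.swap p p' r := fun e => h (by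
    have := congrArg (Equiv.swap p p') e
    simpa using this)
  simp [Equiv.swap_apply_of_ne_of_ne h1 h']

theorem measurePreserving_pooled {q k : ℕ} (n : Fin (k + 1) → ℕ)
    (G : Measure (EuclideanSpace ℝ (Fin q))) [IsProbabilityMeasure G] :
    MeasurePreserving (fun U : Samples q n => pooled U) (sampleLaw n fun _ => G)
      (Measure.pi fun _ => G) := by
  have hm : Measurable fun U : Samples q n => pooled U :=
    measurable_pi_lambda _ fun p => by unfold pooled; fun_prop
  refine ⟨hm, Eq.symm (Measure.pi_eq fun s hs => ?_)⟩
  rw [Measure.map_apply hm (MeasurableSet.univ_pi hs)]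
  have : (fun U : Samples q n => pooled U) ⁻¹' Set.univ.pi s =
      Set.univ.pi fun j => Set.univ.pi fun i => s ⟨j, i⟩ := by
    ext U
    simp [pooled, Set.mem_pi, Sigma.forall]
  rw [this, sampleLaw, Measure.pi_pi, Fintype.prod_sigma]
  simp only [Measure.pi_pi]

/-- The share of the pair `(p, r)` in the sum of all `α`-distances of the sample `u`. -/
def pairShare {V ι : Type*} [NormedAddCommGroup V] [Fintype ι] (α : ℝ) (u : ι → V) (p r : ι) : ℝ :=
  ‖u p - u r‖ ^ α / ∑ p', ∑ r', ‖u p' - u r'‖ ^ α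

variable {V ι : Type*} [NormedAddCommGroup V] [Fintype ι]

theorem pairShare_nonneg (α : ℝ) (u : ι → V) (p r : ι) : 0 ≤ pairShare α u p r := by
  unfold pairShare; positivity

theorem pairShare_self {α : ℝ} (hα : 0 < α) (u : ι → V) (p : ι) : pairShare α u p p = 0 := by
  simp [pairShare, hα.ne']

/-- The sum is `1` unless all distances vanish, when division by zero makes it `0`. -/
theorem sum_pairShare_le_one (α : ℝ) (u : ι → V) : ∑ p, ∑ r, pairShare α u p r ≤ 1 := by
  simp only [pairShare, ← Finset.sum_div]
  exact div_self_le_one _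

theorem pairShare_le_one (α : ℝ) (u : ι → V) (p r : ι) : pairShare α u p r ≤ 1 := by
  refine le_trans ?_ (sum_pairShare_le_one α u)
  refine le_trans ?_ (Finset.single_le_sum (fun p _ => Finset.sum_nonneg fun r _ =>
    pairShare_nonneg α u p r) (Finset.mem_univ p))
  exact Finset.single_le_sum (fun r _ => pairShare_nonneg α u p r) (Finset.mem_univ r)

theorem pairShare_comp_perm (α : ℝ) (u : ι → V) (σ : Equiv.Perm ι) (p r : ι) :
    pairShare α (u ∘ σ) p r = pairShare α u (σ p) (σ r) := by
  simp only [pairShare, Function.comp]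
  congr 1
  rw [Equiv.sum_comp σ (fun p' => ∑ r', ‖u p' - u (σ r')‖ ^ α)]
  exact Finset.sum_congr rfl fun p' _ => Equiv.sum_comp σ (fun r' => ‖u p' - u r'‖ ^ α)

variable [MeasurableSpace V] [BorelSpace V] [SecondCountableTopology V]

theorem measurable_pairShare (α : ℝ) (p r : ι) : Measurable fun u : ι → V => pairShare α u p r := by
  unfold pairShare; fun_prop

theorem integral_pairShare_eq (α : ℝ) (G : Measure V) [IsProbabilityMeasure G] {p r p' r' : ι}
    (h : p ≠ r) (h' : p' ≠ r') :
    ∫ u, pairShare α u p r ∂Measure.pi (fun _ : ι => G) =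
      ∫ u, pairShare α u p' r' ∂Measure.pi (fun _ : ι => G) := by
  classical
  obtain ⟨σ, h1, h2⟩ := exists_perm_apply_eq_apply_eq h h'
  have hmp : MeasurePreserving (fun u : ι → V => u ∘ σ) (Measure.pi fun _ => G)
      (Measure.pi fun _ => G) := by
    exact measurePreserving_arrowCongr' (fun _ : ι => G) (fun _ : ι => G) σ.symm
      (MeasurableEquiv.refl V) (fun _ => MeasurePreserving.id G)
  rw [← hmp.map_eq, integral_map hmp.measurable.aemeasurable
    (measurable_pairShare α p r).aestronglyMeasurable, hmp.map_eq]
  simp only [pairShare_comp_perm, h1, h2]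

end Exchangeability

/-! ### The null hypothesis: boundedness of the critical values -/

section Null

variable {q k : ℕ} {n : Fin (k + 1) → ℕ}

/-- This makes the ratio linear in the pair shares, whose null expectations exchangeability
controls. -/
theorem multiEnergyDist_div_totalDispersion (hn : ∀ j, 0 < n j) (α : ℝ) (U : Samples q n) :
    multiEnergyDist α U / totalDispersion α U = ∑ p, ∑ r, pairShare α (pooled U) p r -
      ∑ j, (totalSize n : ℝ) / n j * ∑ i, ∑ i', pairShare α (pooled U) ⟨j, i⟩ ⟨j, i'⟩ := by
  have hT : (totalSize n : ℝ) ≠ 0 := by exact_mod_cast (totalSize_pos hn).ne'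
  have hS : multiEnergyDist α U = totalDispersion α U - withinDispersion α U := by
    rw [totalDispersion_eq_add hn]; ring
  rw [hS, sub_div]
  simp only [pairShare, ← Finset.sum_div]
  have hd := totalDispersion_eq_sum hn α U
  set D := ∑ p : (Σ j, Fin (n j)), ∑ r, ‖pooled U p - pooled U r‖ ^ α with hD
  rw [hd]
  congr 1
  · rw [mul_div_mul_left _ _ (by simpa using hT)]
  · rw [withinDispersion, Finset.sum_div]
    refine Finset.sum_congr rfl fun j _ => ?_
    have : (n j : ℝ) ≠ 0 := by exact_mod_cast (hn j).ne'
    simp only [meanDist, Fintype.card_fin, pooled]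
    by_cases h0 : D = 0
    · simp [h0]
    · field_simp

theorem sum_ite_eq_zero_else {ι : Type*} [Fintype ι] [DecidableEq ι] (p : ι) (e : ℝ) :
    ∑ r, (if p = r then 0 else e) = (Fintype.card ι - 1) * e := by
  have : ∀ r, (if p = r then 0 else e) = e - if p = r then e else 0 := fun r => by
    split_ifs <;> simp
  simp only [this, Finset.sum_sub_distrib]
  simp
  ring

theorem integrable_pairShare {V ι : Type*} [NormedAddCommGroup V] [Fintype ι] [MeasurableSpace V]
    [BorelSpace V] [SecondCountableTopology V] (α : ℝ) (P : Measure (ι → V)) [IsFiniteMeasure P]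
    (p r : ι) : Integrable (fun u => pairShare α u p r) P :=
  Integrable.of_bound (measurable_pairShare α p r).aestronglyMeasurable 1 (ae_of_all _ fun u => by
    rw [Real.norm_of_nonneg (pairShare_nonneg α u p r)]; exact pairShare_le_one α u p r)

theorem exists_integral_pairShare_eq_ite {V ι : Type*} [NormedAddCommGroup V] [Fintype ι]
    [DecidableEq ι] [MeasurableSpace V] [BorelSpace V] [SecondCountableTopology V] {α : ℝ}
    (hα : 0 < α) (G : Measure V) [IsProbabilityMeasure G] :
    ∃ e : ℝ, ∀ p r, ∫ u, pairShare α u p r ∂Measure.pi (fun _ : ι => G) =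
      if p = r then 0 else e := by
  by_cases h : ∃ p r : ι, p ≠ r
  · obtain ⟨p, r, hpr⟩ := h
    refine ⟨∫ u, pairShare α u p r ∂Measure.pi (fun _ : ι => G), fun p' r' => ?_⟩
    split_ifs with h'
    · subst h'; simp [pairShare_self hα]
    · exact integral_pairShare_eq α G h' hpr
  · push Not at h
    exact ⟨0, fun p r => by simp [h p r, pairShare_self hα]⟩

theorem multiEnergyDist_div_totalDispersion_nonneg {α : ℝ} (h0 : 0 < α) (h2 : α < 2)
    (hn : ∀ j, 0 < n j) (U : Samples q n) : 0 ≤ multiEnergyDist α U / totalDispersion α U :=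
  div_nonneg (multiEnergyDist_nonneg h0 h2 hn U) (totalDispersion_nonneg α U)

/-- Both summands of the total dispersion are nonnegative, so the ratio lies in `[0, 1]`, however
heavy the tails of the law. -/
theorem integrable_multiEnergyDist_div {α : ℝ} (h0 : 0 < α) (h2 : α < 2) (hn : ∀ j, 0 < n j)
    (P : Measure (Samples q n)) [IsFiniteMeasure P] :
    Integrable (fun U : Samples q n => multiEnergyDist α U / totalDispersion α U) P := by
  refine Integrable.of_bound (((measurable_multiEnergyDist hn α).div
    (measurable_totalDispersion α)).aestronglyMeasurable) 1 (ae_of_all _ fun U => ?_)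
  rw [Real.norm_of_nonneg (multiEnergyDist_div_totalDispersion_nonneg h0 h2 hn U)]
  refine div_le_one_of_le₀ ?_ (totalDispersion_nonneg α U)
  rw [totalDispersion_eq_add hn]
  linarith [withinDispersion_nonneg α U]

/-- Under the null hypothesis, the observations are exchangeable, so that on average the
multi-sample energy distance is at most the fraction `k / (T - 1)` of the total dispersion. -/
theorem mul_integral_multiEnergyDist_div_le {α : ℝ} (h0 : 0 < α) (hn : ∀ j, 0 < n j)
    (G : Measure (EuclideanSpace ℝ (Fin q))) [IsProbabilityMeasure G] :
    ((totalSize n : ℝ) - 1) * ∫ U : Samples q n, multiEnergyDist α U / totalDispersion α U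
      ∂(sampleLaw n fun _ => G) ≤ k := by
  classical
  set N : ℝ := (totalSize n : ℝ) with hN
  have hmp := measurePreserving_pooled n G
  set P := Measure.pi (fun _ : (Σ j, Fin (n j)) => G) with hP
  obtain ⟨e, he⟩ := exists_integral_pairShare_eq_ite (ι := Σ j, Fin (n j)) h0 G
  rw [← hP] at he
  have hi := integrable_pairShare (V := EuclideanSpace ℝ (Fin q)) α P
  have hiw : ∀ j, Integrable (fun u => ∑ i, ∑ i', pairShare α u (⟨j, i⟩ : Σ j, Fin (n j)) ⟨j, i'⟩)
      P := fun j => integrable_finsetSum _ fun i _ => integrable_finsetSum _ fun i' _ => hi _ _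
  have hit : Integrable (fun u => ∑ p : (Σ j, Fin (n j)), ∑ r, pairShare α u p r) P :=
    integrable_finsetSum _ fun i _ => integrable_finsetSum _ fun i' _ => hi _ _
  have hcard : (Fintype.card (Σ j, Fin (n j)) : ℝ) = N := by simp [hN, totalSize]
  have htot : ∫ u, ∑ p : (Σ j, Fin (n j)), ∑ r, pairShare α u p r ∂P = N * ((N - 1) * e) := by
    rw [integral_finsetSum _ fun i _ => integrable_finsetSum _ fun i' _ => hi _ _]
    simp_rw [integral_finsetSum _ fun i _ => hi _ i, he, sum_ite_eq_zero_else, hcard]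
    simp only [Finset.sum_const, Finset.card_univ, nsmul_eq_mul, hcard]
  have hwit : ∀ j, ∫ u, ∑ i, ∑ i', pairShare α u (⟨j, i⟩ : Σ j, Fin (n j)) ⟨j, i'⟩ ∂P =
      n j * ((n j - 1) * e) := by
    intro j
    rw [integral_finsetSum _ fun i _ => integrable_finsetSum _ fun i' _ => hi _ _]
    simp_rw [integral_finsetSum _ fun i _ => hi _ _, he, Sigma.mk.injEq, heq_eq_eq, true_and,
      sum_ite_eq_zero_else]
    simp
  have hle : N * ((N - 1) * e) ≤ 1 := by
    rw [← htot]
    calc _ ≤ ∫ _, (1 : ℝ) ∂P := integral_mono hit (integrable_const _) fun u =>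
          sum_pairShare_le_one α u
      _ = 1 := by simp [hP]
  -- Block `j` has `n j * (n j - 1)` off-diagonal pairs, each weighted by `N / n j`. The difference
  -- equals `N * k * e`, and `hle` bounds `N * (N - 1) * e` by `1`.
  have hval : ∫ U : Samples q n, multiEnergyDist α U / totalDispersion α U
      ∂(sampleLaw n fun _ => G) = N * ((N - 1) * e) - N * ((N - (k + 1)) * e) := by
    simp only [multiEnergyDist_div_totalDispersion hn]
    rw [← htot, ← hN]
    have hsum : ∑ j, (N / n j) * (n j * ((n j - 1) * e)) = N * ((N - (k + 1)) * e) := by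
      have : ∀ j, (N / n j) * (n j * ((n j - 1) * e)) = N * e * (n j - 1) := fun j => by
        have : (n j : ℝ) ≠ 0 := by exact_mod_cast (hn j).ne'
        field_simp
      simp only [this, ← Finset.mul_sum, Finset.sum_sub_distrib]
      have : ∑ j, (n j : ℝ) = N := by simp [hN, totalSize]
      rw [this]
      simp
      ring
    rw [← hsum]
    simp only [← hwit, ← integral_const_mul]
    rw [← integral_finsetSum _ fun j _ => (hiw j).const_mul _,
      ← integral_sub hit (integrable_finsetSum _ fun j _ => (hiw j).const_mul _),
      ← hmp.map_eq, integral_map hmp.measurable.aemeasurable]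
    have := (hit.sub (integrable_finsetSum Finset.univ
      fun j _ => (hiw j).const_mul (N / n j))).aestronglyMeasurable
    rw [hmp.map_eq]
    exact this
  rw [hval]
  have hk : (0 : ℝ) ≤ k := k.cast_nonneg
  nlinarith [mul_le_mul_of_nonneg_left hle hk]

/-- Exceeding `c` forces `c k W ≤ (T - k - 1) S`; adding `c k S` to both sides turns `W` into the
total dispersion `S + W`. -/
theorem le_div_of_lt_ratioStat {α : ℝ} (h0 : 0 < α) (h2 : α < 2) (hk : 1 ≤ k) (hn : ∀ j, 0 < n j)
    (hN : (k : ℝ) + 1 < totalSize n) {c : ℝ} (hc : 0 ≤ c) {U : Samples q n}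
    (h : ENNReal.ofReal c < ratioStat α U) :
    c * k / ((totalSize n : ℝ) - k - 1 + c * k) ≤ multiEnergyDist α U / totalDispersion α U := by
  have hk' : (0 : ℝ) < k := by exact_mod_cast hk
  have hW := withinDispersion_nonneg α U
  have hS0 := multiEnergyDist_nonneg h0 h2 hn U
  have hT := totalDispersion_eq_add hn α U
  have hm : 0 < (totalSize n : ℝ) - k - 1 := by linarith
  set m := (totalSize n : ℝ) - k - 1 with hmdef
  have hS : 0 < multiEnergyDist α U := by
    refine lt_of_le_of_ne hS0 fun e => ?_
    simp [ratioStat, ← e] at h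
  have h1 := ENNReal.mul_le_of_le_div h.le
  rw [← ENNReal.ofReal_mul hc, ENNReal.ofReal_le_ofReal_iff (by positivity)] at h1
  rw [← hmdef, ← mul_div_assoc, div_le_div_iff₀ hm hk'] at h1
  rw [div_le_div_iff₀ (by positivity) (by linarith), hT]
  nlinarith

theorem rejectionProb_null_le {α : ℝ} (h0 : 0 < α) (h2 : α < 2) (hk : 1 ≤ k) (hn : ∀ j, 0 < n j)
    (hN : (k : ℝ) + 1 < totalSize n) {c : ℝ} (hc : 0 < c)
    (G : Measure (EuclideanSpace ℝ (Fin q))) [IsProbabilityMeasure G] :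
    rejectionProb α n (ENNReal.ofReal c) (fun _ => G) ≤
      ENNReal.ofReal (((totalSize n : ℝ) - k - 1 + c * k) / (c * ((totalSize n : ℝ) - 1))) := by
  have hk' : (0 : ℝ) < k := by exact_mod_cast hk
  set N : ℝ := (totalSize n : ℝ) with hNdef
  have hm : 0 < N - k - 1 := by linarith
  set x := c * k / (N - k - 1 + c * k) with hx
  have hxpos : 0 < x := by positivity
  have : IsProbabilityMeasure (sampleLaw (q := q) n fun _ => G) := by
    unfold sampleLaw; infer_instance
  set P := sampleLaw (q := q) n fun _ => G with hP
  have hmark := mul_meas_ge_le_integral_of_nonneg (μ := P)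
    (ae_of_all _ fun U => multiEnergyDist_div_totalDispersion_nonneg h0 h2 hn U)
    (integrable_multiEnergyDist_div h0 h2 hn P) x
  have hint := mul_integral_multiEnergyDist_div_le h0 hn G
  rw [← hP, ← hNdef] at hint
  rw [rejectionProb, ← hP]
  refine (measure_mono (t := {U | x ≤ multiEnergyDist α U / totalDispersion α U})
    fun U hU => le_div_of_lt_ratioStat h0 h2 hk hn hN hc.le hU).trans ?_
  rw [← ofReal_measureReal]
  refine ENNReal.ofReal_le_ofReal ?_
  set I := ∫ U, multiEnergyDist α U / totalDispersion α U ∂P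
  have hN1 : 0 < N - 1 := by linarith
  have h3 : P.real {U | x ≤ multiEnergyDist α U / totalDispersion α U} ≤ I / x := by
    rw [le_div_iff₀ hxpos, mul_comm]; exact hmark
  refine h3.trans ?_
  have h4 : I ≤ k / (N - 1) := by rw [le_div_iff₀ hN1, mul_comm]; exact hint
  refine (div_le_div_of_nonneg_right h4 hxpos.le).trans (le_of_eq ?_)
  rw [hx]
  field_simp

/-- The Markov bound on the null rejection probability at threshold `c` tends to `1 / c` as `T`
grows. Taking `c = 2 / a` gives the limit `a / 2`, so the bound is at most `a` once `T` is large. -/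
theorem criticalValue_le {α : ℝ} (h0 : 0 < α) (h2 : α < 2) (hk : 1 ≤ k) (hn : ∀ j, 0 < n j)
    (hN : (k : ℝ) + 1 < totalSize n) {a : ℝ} (ha : 0 < a)
    (hNa : 2 / a * k ≤ (totalSize n : ℝ) - 1) :
    criticalValue q α n a ≤ ENNReal.ofReal (2 / a) := by
  refine sInf_le fun G _ => (rejectionProb_null_le h0 h2 hk hn hN (by positivity) G).trans
    (ENNReal.ofReal_le_ofReal ?_)
  have hk' : (0 : ℝ) < k := by exact_mod_cast hk
  have hN1 : 0 < (totalSize n : ℝ) - 1 := by linarith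
  rw [div_le_iff₀ (by positivity)]
  have : a * (2 / a * ((totalSize n : ℝ) - 1)) = 2 * ((totalSize n : ℝ) - 1) := by field_simp
  rw [this]
  linarith

end Null

/-! ### Mean-square convergence of empirical characteristic functions -/

section EmpiricalCharFun

theorem abs_sampleMean_le_one {V : Type*} {n : ℕ} {f : V → ℝ} (hf : ∀ x, |f x| ≤ 1)
    (A : Fin n → V) : |sampleMean f A| ≤ 1 := by
  rcases Nat.eq_zero_or_pos n with rfl | hn
  · simp [sampleMean]
  have hn' : (0 : ℝ) < n := by exact_mod_cast hn
  rw [sampleMean, abs_mul, abs_of_pos (inv_pos.2 hn'), inv_mul_le_iff₀ hn', mul_one]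
  calc _ ≤ ∑ i, |f (A i)| := Finset.abs_sum_le_sum_abs _ _
    _ ≤ ∑ _i : Fin n, (1 : ℝ) := Finset.sum_le_sum fun i _ => hf _
    _ = n := by simp

/-- Variances of independent terms add, and a function bounded by `1` has variance at most `1`. -/
theorem integral_sampleMean_sub_sq_le {V : Type*} [MeasurableSpace V] {n : ℕ} (hn : 0 < n)
    (G : Measure V) [IsProbabilityMeasure G] {f : V → ℝ} (hf : Measurable f)
    (hb : ∀ x, |f x| ≤ 1) :
    ∫ A : Fin n → V, (sampleMean f A - ∫ x, f x ∂G) ^ 2 ∂Measure.pi (fun _ => G) ≤ (n : ℝ)⁻¹ := by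
  have hn' : (0 : ℝ) < n := by exact_mod_cast hn
  have hL : MemLp f 2 G := MemLp.of_bound hf.aestronglyMeasurable 1 (ae_of_all _ hb)
  have hvar := ProbabilityTheory.variance_sum_pi (μ := fun _ : Fin n => G) (X := fun _ => f)
    (fun _ => hL)
  have hv1 : ProbabilityTheory.variance f G ≤ 1 := by
    refine (ProbabilityTheory.variance_le_expectation_sq hf.aestronglyMeasurable).trans ?_
    calc ∫ x, (f ^ 2) x ∂G ≤ ∫ _, (1 : ℝ) ∂G := by
          refine integral_mono hL.integrable_sq (integrable_const _) fun x => ?_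
          exact (sq_le_one_iff_abs_le_one _).2 (hb x)
      _ = 1 := by simp
  have hfi : ∀ i : Fin n, Integrable (fun A : Fin n → V => f (A i)) (Measure.pi fun _ => G) :=
    fun i => (measurePreserving_eval (fun _ : Fin n => G) i).integrable_comp_of_integrable
      (hL.integrable (by norm_num))
  have hmean : ∫ A, (∑ i, fun A : Fin n → V => f (A i)) A ∂Measure.pi (fun _ => G) =
      n * ∫ x, f x ∂G := by
    simp only [Finset.sum_apply]
    rw [integral_finsetSum _ fun i _ => hfi i]
    have : ∀ i : Fin n, ∫ A : Fin n → V, f (A i) ∂Measure.pi (fun _ => G) = ∫ x, f x ∂G :=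
      fun i => integral_comp_eval (μ := fun _ : Fin n => G) hf.aestronglyMeasurable
    simp [this]
  rw [ProbabilityTheory.variance_eq_integral
    (Finset.aemeasurable_sum _ fun i _ => (hfi i).aemeasurable), hmean] at hvar
  have hrew : ∀ A : Fin n → V, (sampleMean f A - ∫ x, f x ∂G) ^ 2 =
      (n : ℝ)⁻¹ ^ 2 * ((∑ i, fun A : Fin n → V => f (A i)) A - n * ∫ x, f x ∂G) ^ 2 := by
    intro A
    rw [← mul_pow, mul_sub, inv_mul_cancel_left₀ hn'.ne', sampleMean, Finset.sum_apply]
  simp only [hrew]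
  rw [integral_const_mul, hvar]
  simp only [Finset.sum_const, Finset.card_univ, Fintype.card_fin, nsmul_eq_mul]
  calc (n : ℝ)⁻¹ ^ 2 * (n * ProbabilityTheory.variance f G) ≤ (n : ℝ)⁻¹ ^ 2 * (n * 1) := by gcongr
    _ = (n : ℝ)⁻¹ := by field_simp

theorem empFourierDist_le {V : Type*} [NormedAddCommGroup V] [InnerProductSpace ℝ V]
    {n m : ℕ} (A : Fin n → V) (B : Fin m → V) (t : V) :
    empFourierDist A B t ≤ 8 := by
  have hc := abs_le.1 (abs_sampleMean_le_one (fun x => Real.abs_cos_le_one (inner ℝ x t)) A)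
  have hs := abs_le.1 (abs_sampleMean_le_one (fun x => Real.abs_sin_le_one (inner ℝ x t)) A)
  have hc' := abs_le.1 (abs_sampleMean_le_one (fun x => Real.abs_cos_le_one (inner ℝ x t)) B)
  have hs' := abs_le.1 (abs_sampleMean_le_one (fun x => Real.abs_sin_le_one (inner ℝ x t)) B)
  unfold empFourierDist
  nlinarith

variable {V : Type*} [NormedAddCommGroup V] [InnerProductSpace ℝ V] [MeasurableSpace V]

/-- The squared distance between the characteristic function of a sample and that of `G`. -/
def charFunError {n : ℕ} (G : Measure V) (A : Fin n → V) (t : V) : ℝ :=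
  (sampleMean (fun x => Real.cos (inner ℝ x t)) A - (charFun G t).re) ^ 2 +
    (sampleMean (fun x => Real.sin (inner ℝ x t)) A - (charFun G t).im) ^ 2

theorem charFunError_nonneg {n : ℕ} (G : Measure V) (A : Fin n → V) (t : V) :
    0 ≤ charFunError G A t := by
  unfold charFunError; positivity

theorem charFunError_le {n : ℕ} (G : Measure V) [IsProbabilityMeasure G] (A : Fin n → V) (t : V) :
    charFunError G A t ≤ 8 := by
  have hc := abs_le.1 (abs_sampleMean_le_one (fun x => Real.abs_cos_le_one (inner ℝ x t)) A)
  have hs := abs_le.1 (abs_sampleMean_le_one (fun x => Real.abs_sin_le_one (inner ℝ x t)) A)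
  have hr := abs_le.1 ((Complex.abs_re_le_norm _).trans (norm_charFun_le_one (μ := G) t))
  have hi := abs_le.1 ((Complex.abs_im_le_norm _).trans (norm_charFun_le_one (μ := G) t))
  unfold charFunError
  nlinarith

/-- The difference is split through the two empirical characteristic functions; the `3` comes from
`(x + y + z) ^ 2 ≤ 3 (x ^ 2 + y ^ 2 + z ^ 2)`. -/
theorem norm_charFun_sub_sq_le {n m : ℕ} (G H : Measure V) (A : Fin n → V) (B : Fin m → V)
    (t : V) : ‖charFun G t - charFun H t‖ ^ 2 ≤
      3 * (charFunError G A t + empFourierDist A B t + charFunError H B t) := by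
  rw [← Complex.normSq_eq_norm_sq, Complex.normSq_apply, Complex.sub_re, Complex.sub_im]
  unfold charFunError empFourierDist
  have h : ∀ a b c d : ℝ, (a - d) * (a - d) ≤ 3 * ((b - a) ^ 2 + (b - c) ^ 2 + (c - d) ^ 2) :=
    fun a b c d => by
      nlinarith [sq_nonneg ((b - a) + (b - c)), sq_nonneg ((b - a) + (c - d)),
        sq_nonneg ((b - c) - (c - d))]
  have h1 := h (charFun G t).re (sampleMean (fun x => Real.cos (inner ℝ x t)) A)
    (sampleMean (fun x => Real.cos (inner ℝ x t)) B) (charFun H t).re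
  have h2 := h (charFun G t).im (sampleMean (fun x => Real.sin (inner ℝ x t)) A)
    (sampleMean (fun x => Real.sin (inner ℝ x t)) B) (charFun H t).im
  linarith

variable [BorelSpace V] [FiniteDimensional ℝ V]

theorem integrable_exp_inner_mul_I (G : Measure V) [IsFiniteMeasure G] (t : V) :
    Integrable (fun x => Complex.exp ((inner ℝ x t : ℝ) * Complex.I)) G :=
  Integrable.of_bound (by fun_prop) 1 (ae_of_all _ fun x => by simp)

theorem re_charFun (G : Measure V) [IsFiniteMeasure G] (t : V) :
    (charFun G t).re = ∫ x, Real.cos (inner ℝ x t) ∂G := by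
  rw [charFun_apply, ← Complex.reCLM_apply,
    ← ContinuousLinearMap.integral_comp_comm _ (integrable_exp_inner_mul_I G t)]
  simp only [Complex.reCLM_apply, Complex.exp_ofReal_mul_I_re]

theorem im_charFun (G : Measure V) [IsFiniteMeasure G] (t : V) :
    (charFun G t).im = ∫ x, Real.sin (inner ℝ x t) ∂G := by
  rw [charFun_apply, ← Complex.imCLM_apply,
    ← ContinuousLinearMap.integral_comp_comm _ (integrable_exp_inner_mul_I G t)]
  simp only [Complex.imCLM_apply, Complex.exp_ofReal_mul_I_im]

theorem measurable_charFunError {n : ℕ} (G : Measure V) [IsFiniteMeasure G] :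
    Measurable fun p : (Fin n → V) × V => charFunError G p.1 p.2 := by
  have h1 : Measurable fun p : (Fin n → V) × V => (charFun G p.2).re :=
    Complex.measurable_re.comp (measurable_charFun.comp measurable_snd)
  have h2 : Measurable fun p : (Fin n → V) × V => (charFun G p.2).im :=
    Complex.measurable_im.comp (measurable_charFun.comp measurable_snd)
  unfold charFunError sampleMean
  fun_prop

theorem integrable_charFunError {n : ℕ} (G : Measure V) [IsProbabilityMeasure G] (A : Fin n → V) :
    Integrable (charFunError G A) (gaussWeight V) :=
  Integrable.of_bound (measurable_charFunError G |>.comp measurable_prodMk_left).aestronglyMeasurable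
    8 (ae_of_all _ fun t => by
      rw [Real.norm_of_nonneg (charFunError_nonneg G A t)]; exact charFunError_le G A t)

theorem integrable_empFourierDist {n m : ℕ} (A : Fin n → V) (B : Fin m → V) :
    Integrable (empFourierDist A B) (gaussWeight V) := by
  refine Integrable.of_bound (Continuous.aestronglyMeasurable ?_) 8 (ae_of_all _ fun t => by
      rw [Real.norm_of_nonneg (empFourierDist_nonneg A B t)]; exact empFourierDist_le A B t)
  unfold empFourierDist sampleMean
  fun_prop

theorem integral_charFunError_le {n : ℕ} (hn : 0 < n) (G : Measure V) [IsProbabilityMeasure G]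
    (t : V) : ∫ A : Fin n → V, charFunError G A t ∂Measure.pi (fun _ => G) ≤ 2 * (n : ℝ)⁻¹ := by
  have hm : ∀ (f : V → ℝ), Measurable f → (∀ x, |f x| ≤ 1) → Integrable (fun A : Fin n → V =>
      (sampleMean f A - ∫ x, f x ∂G) ^ 2) (Measure.pi fun _ => G) := by
    intro f hf hb
    refine Integrable.of_bound (Measurable.aestronglyMeasurable ?_) 4 (ae_of_all _ fun A => ?_)
    · unfold sampleMean; fun_prop
    · have h1 := abs_le.1 (abs_sampleMean_le_one hb A)
      have h2 : |∫ x, f x ∂G| ≤ 1 := by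
        have := norm_integral_le_of_norm_le_const (μ := G) (f := f) (C := 1) (ae_of_all _ hb)
        simpa using this
      have h2 := abs_le.1 h2
      rw [Real.norm_of_nonneg (sq_nonneg _)]
      nlinarith
  have hmc : Measurable fun x : V => Real.cos (inner ℝ x t) := by fun_prop
  have hms : Measurable fun x : V => Real.sin (inner ℝ x t) := by fun_prop
  simp only [charFunError, re_charFun, im_charFun]
  rw [integral_add (hm _ hmc fun x => Real.abs_cos_le_one _)
    (hm _ hms fun x => Real.abs_sin_le_one _)]
  linarith [integral_sampleMean_sub_sq_le hn G hmc fun x => Real.abs_cos_le_one _,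
    integral_sampleMean_sub_sq_le hn G hms fun x => Real.abs_sin_le_one _]

theorem integrable_integral_charFunError {n : ℕ} (G : Measure V) [IsProbabilityMeasure G] :
    Integrable (fun A : Fin n → V => ∫ t, charFunError G A t ∂gaussWeight V)
      (Measure.pi fun _ => G) := by
  have : Integrable (fun p : (Fin n → V) × V => charFunError G p.1 p.2)
      ((Measure.pi fun _ => G).prod (gaussWeight V)) :=
    Integrable.of_bound (measurable_charFunError G).aestronglyMeasurable 8 (ae_of_all _ fun p => by
      rw [Real.norm_of_nonneg (charFunError_nonneg G _ _)]; exact charFunError_le G _ _)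
  exact this.integral_prod_left

theorem integral_integral_charFunError_le {n : ℕ} (hn : 0 < n) (G : Measure V)
    [IsProbabilityMeasure G] :
    ∫ A : Fin n → V, ∫ t, charFunError G A t ∂gaussWeight V ∂Measure.pi (fun _ => G) ≤
      (gaussWeight V).real Set.univ * (2 * (n : ℝ)⁻¹) := by
  have hint : Integrable (fun p : (Fin n → V) × V => charFunError G p.1 p.2)
      ((Measure.pi fun _ => G).prod (gaussWeight V)) :=
    Integrable.of_bound (measurable_charFunError G).aestronglyMeasurable 8 (ae_of_all _ fun p => by
      rw [Real.norm_of_nonneg (charFunError_nonneg G _ _)]; exact charFunError_le G _ _)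
  rw [integral_integral_swap hint]
  calc _ ≤ ∫ _, 2 * (n : ℝ)⁻¹ ∂gaussWeight V :=
        integral_mono hint.integral_prod_right (integrable_const _) fun t =>
          integral_charFunError_le hn G t
    _ = _ := by simp

theorem integrable_norm_charFun_sub_sq (G H : Measure V) [IsProbabilityMeasure G]
    [IsProbabilityMeasure H] :
    Integrable (fun t => ‖charFun G t - charFun H t‖ ^ 2) (gaussWeight V) := by
  refine Integrable.of_bound (by fun_prop) 4 (ae_of_all _ fun t => ?_)
  rw [Real.norm_of_nonneg (by positivity)]
  have h := (norm_sub_le (charFun G t) (charFun H t)).trans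
    (add_le_add (norm_charFun_le_one t) (norm_charFun_le_one t))
  nlinarith [norm_nonneg (charFun G t - charFun H t)]

/-- Characteristic functions determine the law and are continuous, so a difference at one point
persists nearby, where the Gaussian density is positive. -/
theorem integral_norm_charFun_sub_sq_pos {G H : Measure V} [IsProbabilityMeasure G]
    [IsProbabilityMeasure H] (hne : G ≠ H) :
    0 < ∫ t, ‖charFun G t - charFun H t‖ ^ 2 ∂gaussWeight V := by
  obtain ⟨t, ht⟩ : ∃ t, charFun G t ≠ charFun H t := by
    by_contra! h
    exact hne (Measure.ext_of_charFun (funext h))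
  have hG : Continuous (charFun G) := continuous_charFun
  have hH : Continuous (charFun H) := continuous_charFun
  rw [integral_gaussWeight]
  refine integral_pos_of_integrable_nonneg_nonzero (x := t) (by fun_prop) ?_
    (fun t => by positivity) ?_
  · refine (integrable_exp_neg_mul_sq_norm (by norm_num)).bdd_mul (c := 4) (by fun_prop)
      (ae_of_all _ fun t => ?_)
    rw [Real.norm_of_nonneg (by positivity)]
    have h := (norm_sub_le (charFun G t) (charFun H t)).trans
      (add_le_add (norm_charFun_le_one t) (norm_charFun_le_one t))
    nlinarith [norm_nonneg (charFun G t - charFun H t)]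
  · have : 0 < ‖charFun G t - charFun H t‖ := norm_pos_iff.2 (sub_ne_zero.2 ht)
    positivity

theorem integral_norm_charFun_sub_sq_le {n m : ℕ} (G H : Measure V) [IsProbabilityMeasure G]
    [IsProbabilityMeasure H] (A : Fin n → V) (B : Fin m → V) :
    ∫ t, ‖charFun G t - charFun H t‖ ^ 2 ∂gaussWeight V ≤
      3 * ((∫ t, charFunError G A t ∂gaussWeight V) + (∫ t, empFourierDist A B t ∂gaussWeight V) +
        ∫ t, charFunError H B t ∂gaussWeight V) := by
  have h1 := integrable_charFunError G A
  have h2 := integrable_empFourierDist A B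
  have h3 := integrable_charFunError H B
  have h12 : Integrable (fun t => charFunError G A t + empFourierDist A B t) (gaussWeight V) :=
    h1.add h2
  have h123 : Integrable (fun t => 3 * (charFunError G A t + empFourierDist A B t +
      charFunError H B t)) (gaussWeight V) := (h12.add h3).const_mul 3
  refine (integral_mono (integrable_norm_charFun_sub_sq G H) h123
    fun t => norm_charFun_sub_sq_le G H A B t).trans (le_of_eq ?_)
  rw [integral_const_mul, integral_add h12 h3, integral_add h1 h2]

end EmpiricalCharFun

/-! ### Fixed alternatives: divergence of the statistic -/

section Alternative

variable {q k : ℕ} {n : Fin (k + 1) → ℕ}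

instance isProbabilityMeasure_sampleLaw (F : Fin (k + 1) → Measure (EuclideanSpace ℝ (Fin q)))
    [∀ j, IsProbabilityMeasure (F j)] : IsProbabilityMeasure (sampleLaw n F) := by
  unfold sampleLaw; infer_instance

theorem norm_sub_rpow_le {V : Type*} [NormedAddCommGroup V] {α : ℝ} (h0 : 0 < α) (h2 : α < 2)
    (x y : V) : ‖x - y‖ ^ α ≤ 1 + 2 * ‖x‖ ^ 2 + 2 * ‖y‖ ^ 2 := by
  have h1 : ‖x - y‖ ^ α ≤ 1 + ‖x - y‖ ^ 2 := by
    rcases le_total ‖x - y‖ 1 with h | h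
    · have := Real.rpow_le_one (norm_nonneg _) h h0.le
      nlinarith [sq_nonneg ‖x - y‖]
    · have := Real.rpow_le_rpow_of_exponent_le h h2.le
      rw [Real.rpow_two] at this
      linarith
  have h3 := norm_sub_le x y
  nlinarith [norm_nonneg (x - y), sq_nonneg (‖x‖ - ‖y‖)]

/-- Trading `α`-distances for squared norms of single observations gives a mean at most linear in
`T`, under second moments alone. -/
theorem withinDispersion_le {α : ℝ} (h0 : 0 < α) (h2 : α < 2) (hn : ∀ j, 0 < n j)
    (U : Samples q n) :
    withinDispersion α U ≤ ∑ j, ((n j : ℝ) / 2 + 2 * ∑ i, ‖U j i‖ ^ 2) := by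
  refine Finset.sum_le_sum fun j _ => ?_
  have hj : (0 : ℝ) < n j := by exact_mod_cast hn j
  have h : ∑ i, ∑ i', ‖U j i - U j i'‖ ^ α ≤ (n j : ℝ) * (n j + 4 * ∑ i, ‖U j i‖ ^ 2) := by
    calc _ ≤ ∑ i, ∑ i', (1 + 2 * ‖U j i‖ ^ 2 + 2 * ‖U j i'‖ ^ 2) :=
          Finset.sum_le_sum fun i _ => Finset.sum_le_sum fun i' _ => norm_sub_rpow_le h0 h2 _ _
      _ = _ := by
          simp only [Finset.sum_add_distrib, ← Finset.mul_sum, Finset.sum_const, Finset.card_univ,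
            Fintype.card_fin, nsmul_eq_mul]
          ring
  simp only [meanDist, Fintype.card_fin]
  calc _ ≤ (n j : ℝ) / 2 * (1 / (n j * n j) * ((n j : ℝ) * (n j + 4 * ∑ i, ‖U j i‖ ^ 2))) := by
        gcongr
    _ = _ := by field_simp; ring

theorem integrable_comp_sample {F : Fin (k + 1) → Measure (EuclideanSpace ℝ (Fin q))}
    [∀ j, IsProbabilityMeasure (F j)] {j : Fin (k + 1)}
    {f : (Fin (n j) → EuclideanSpace ℝ (Fin q)) → ℝ}
    (hf : Integrable f (Measure.pi fun _ => F j)) :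
    Integrable (fun U : Samples q n => f (U j)) (sampleLaw n F) :=
  integrable_comp_eval (μ := fun j => Measure.pi fun _ : Fin (n j) => F j) hf

theorem integral_comp_sample {F : Fin (k + 1) → Measure (EuclideanSpace ℝ (Fin q))}
    [∀ j, IsProbabilityMeasure (F j)] {j : Fin (k + 1)}
    {f : (Fin (n j) → EuclideanSpace ℝ (Fin q)) → ℝ}
    (hf : Integrable f (Measure.pi fun _ => F j)) :
    ∫ U : Samples q n, f (U j) ∂sampleLaw n F = ∫ A, f A ∂Measure.pi fun _ => F j :=
  integral_comp_eval (μ := fun j => Measure.pi fun _ : Fin (n j) => F j) hf.aestronglyMeasurable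

theorem integrable_comp_observation {F : Fin (k + 1) → Measure (EuclideanSpace ℝ (Fin q))}
    [∀ j, IsProbabilityMeasure (F j)] {f : EuclideanSpace ℝ (Fin q) → ℝ} {j : Fin (k + 1)}
    (hf : Integrable f (F j)) (i : Fin (n j)) :
    Integrable (fun U : Samples q n => f (U j i)) (sampleLaw n F) :=
  integrable_comp_sample (f := fun A => f (A i))
    (integrable_comp_eval (μ := fun _ : Fin (n j) => F j) hf)

theorem integral_comp_observation {F : Fin (k + 1) → Measure (EuclideanSpace ℝ (Fin q))}
    [∀ j, IsProbabilityMeasure (F j)] {f : EuclideanSpace ℝ (Fin q) → ℝ} {j : Fin (k + 1)}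
    (hf : Integrable f (F j)) (i : Fin (n j)) :
    ∫ U : Samples q n, f (U j i) ∂sampleLaw n F = ∫ x, f x ∂F j := by
  rw [← integral_comp_eval (μ := fun _ : Fin (n j) => F j) (i := i) hf.aestronglyMeasurable]
  exact integral_comp_sample (f := fun A => f (A i))
    (integrable_comp_eval (μ := fun _ : Fin (n j) => F j) hf)

theorem integrable_withinDispersion {α : ℝ} (h0 : 0 < α) (h2 : α < 2) (hn : ∀ j, 0 < n j)
    {F : Fin (k + 1) → Measure (EuclideanSpace ℝ (Fin q))} [∀ j, IsProbabilityMeasure (F j)]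
    (hF : ∀ j, Integrable (fun x => ‖x‖ ^ 2) (F j)) :
    Integrable (fun U : Samples q n => withinDispersion α U) (sampleLaw n F) := by
  have : Integrable (fun U : Samples q n => ∑ j, ((n j : ℝ) / 2 + 2 * ∑ i, ‖U j i‖ ^ 2))
      (sampleLaw n F) := integrable_finsetSum _ fun j _ => (integrable_const _).add
    ((integrable_finsetSum _ fun i _ => integrable_comp_observation (hF j) i).const_mul 2)
  refine this.mono' (measurable_withinDispersion α).aestronglyMeasurable (ae_of_all _ fun U => ?_)
  rw [Real.norm_of_nonneg (withinDispersion_nonneg α U)]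
  exact withinDispersion_le h0 h2 hn U

theorem integral_withinDispersion_le {α : ℝ} (h0 : 0 < α) (h2 : α < 2) (hn : ∀ j, 0 < n j)
    {F : Fin (k + 1) → Measure (EuclideanSpace ℝ (Fin q))} [∀ j, IsProbabilityMeasure (F j)]
    (hF : ∀ j, Integrable (fun x => ‖x‖ ^ 2) (F j)) :
    ∫ U : Samples q n, withinDispersion α U ∂sampleLaw n F ≤
      totalSize n * (1 / 2 + 2 * ∑ j, ∫ x, ‖x‖ ^ 2 ∂F j) := by
  have hi : ∀ j, Integrable (fun U : Samples q n => 2 * ∑ i, ‖U j i‖ ^ 2) (sampleLaw n F) :=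
    fun j => (integrable_finsetSum _ fun i _ => integrable_comp_observation (hF j) i).const_mul 2
  have hi' : ∀ j, Integrable (fun U : Samples q n => (n j : ℝ) / 2 + 2 * ∑ i, ‖U j i‖ ^ 2)
      (sampleLaw n F) := fun j => (integrable_const _).add (hi j)
  have hM : ∀ j, ∫ x, ‖x‖ ^ 2 ∂F j ≤ ∑ j, ∫ x, ‖x‖ ^ 2 ∂F j := fun j =>
    Finset.single_le_sum (f := fun j => ∫ x, ‖x‖ ^ 2 ∂F j)
      (fun j _ => integral_nonneg fun x => by positivity) (Finset.mem_univ j)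
  set M := ∑ j, ∫ x, ‖x‖ ^ 2 ∂F j
  refine (integral_mono (integrable_withinDispersion h0 h2 hn hF)
    (integrable_finsetSum _ fun j _ => hi' j) fun U => withinDispersion_le h0 h2 hn U).trans ?_
  rw [integral_finsetSum _ fun j _ => hi' j]
  have hj : ∀ j, ∫ U : Samples q n, ((n j : ℝ) / 2 + 2 * ∑ i, ‖U j i‖ ^ 2) ∂sampleLaw n F =
      n j / 2 + 2 * (n j * ∫ x, ‖x‖ ^ 2 ∂F j) := by
    intro j
    rw [integral_add (integrable_const _) (hi j), integral_const_mul,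
      integral_finsetSum _ fun i _ => integrable_comp_observation (hF j) i]
    simp only [integral_comp_observation (hF j)]
    simp
  simp only [hj]
  calc _ ≤ ∑ j, (n j : ℝ) * (1 / 2 + 2 * M) := Finset.sum_le_sum fun j _ => by
        have := mul_le_mul_of_nonneg_left (hM j) ((n j).cast_nonneg (α := ℝ))
        linarith
    _ = _ := by rw [← Finset.sum_mul]; simp [totalSize]

/-- The sum over the samples of the integrated squared errors of the empirical characteristic
functions. -/
def totalCharFunError (F : Fin (k + 1) → Measure (EuclideanSpace ℝ (Fin q))) (U : Samples q n) :
    ℝ := ∑ j, ∫ t, charFunError (F j) (U j) t ∂gaussWeight (EuclideanSpace ℝ (Fin q))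

variable (F : Fin (k + 1) → Measure (EuclideanSpace ℝ (Fin q))) [∀ j, IsProbabilityMeasure (F j)]

theorem integrable_totalCharFunError :
    Integrable (fun U : Samples q n => totalCharFunError F U) (sampleLaw n F) :=
  integrable_finsetSum _ fun j _ => integrable_comp_sample
    (f := fun A => ∫ t, charFunError (F j) A t ∂gaussWeight (EuclideanSpace ℝ (Fin q)))
    (integrable_integral_charFunError (F j))

theorem integral_totalCharFunError_le {N : ℕ} (hN : 0 < N) (hn : ∀ j, N ≤ n j) :
    ∫ U : Samples q n, totalCharFunError F U ∂sampleLaw n F ≤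
      2 * (k + 1) * (gaussWeight (EuclideanSpace ℝ (Fin q))).real Set.univ / N := by
  have hN' : (0 : ℝ) < N := by exact_mod_cast hN
  have hint : ∀ j, Integrable (fun A : Fin (n j) → EuclideanSpace ℝ (Fin q) =>
      ∫ t, charFunError (F j) A t ∂gaussWeight (EuclideanSpace ℝ (Fin q)))
      (Measure.pi fun _ => F j) := fun j => integrable_integral_charFunError (F j)
  unfold totalCharFunError
  rw [integral_finsetSum _ fun j _ => integrable_comp_sample (hint j)]
  calc _ ≤ ∑ _j : Fin (k + 1),
        (gaussWeight (EuclideanSpace ℝ (Fin q))).real Set.univ * (2 * (N : ℝ)⁻¹) := by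
        refine Finset.sum_le_sum fun j _ => ?_
        rw [integral_comp_sample (hint j)]
        refine (integral_integral_charFunError_le (hN.trans_le (hn j)) (F j)).trans ?_
        have : (N : ℝ) ≤ n j := by exact_mod_cast hn j
        gcongr
    _ = _ := by simp; field_simp

/-- The multi-sample energy distance grows at least linearly in the smallest sample size as long
as the empirical characteristic functions are close to the true ones. -/
theorem exists_mul_sub_le_multiEnergyDist {α : ℝ} (h0 : 0 < α) (h2 : α < 2)
    (hne : ∃ i j, F i ≠ F j) :
    ∃ c δ : ℝ, 0 < c ∧ 0 < δ ∧ ∀ (N : ℕ) (n : Fin (k + 1) → ℕ), 0 < N → (∀ j, N ≤ n j) →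
      ∀ U : Samples q n, c * N * (δ - totalCharFunError F U) ≤ multiEnergyDist α U := by
  obtain ⟨c, hc, hcE⟩ := exists_mul_integral_empFourierDist_le q h0 h2
  set Λ := gaussWeight (EuclideanSpace ℝ (Fin q)) with hΛ
  obtain ⟨δ, hδ, hδF⟩ : ∃ δ : ℝ, 0 < δ ∧ ∀ i j, F i ≠ F j →
      δ ≤ ∫ t, ‖charFun (F i) t - charFun (F j) t‖ ^ 2 ∂Λ := by
    classical
    set g : Fin (k + 1) × Fin (k + 1) → ℝ := fun p => if F p.1 = F p.2 then 1 else
      ∫ t, ‖charFun (F p.1) t - charFun (F p.2) t‖ ^ 2 ∂Λ with hg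
    obtain ⟨p, hp⟩ := Finite.exists_min g
    refine ⟨g p, ?_, fun i j hij => ?_⟩
    · simp only [hg]
      split_ifs with h
      · exact one_pos
      · exact integral_norm_charFun_sub_sq_pos h
    · have := hp (i, j)
      rwa [show g (i, j) = ∫ t, ‖charFun (F i) t - charFun (F j) t‖ ^ 2 ∂Λ by
        simp [hg, hij]] at this
  refine ⟨c / (2 * (k + 1)), δ / 3, by positivity, by positivity, fun N n hN hn U => ?_⟩
  have hn0 : ∀ j, 0 < n j := fun j => hN.trans_le (hn j)
  rcases le_or_gt (δ / 3) (totalCharFunError F U) with hbig | hsmall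
  · refine le_trans ?_ (multiEnergyDist_nonneg h0 h2 hn0 U)
    exact mul_nonpos_of_nonneg_of_nonpos (by positivity) (by linarith)
  -- Pairing a largest sample `l` with some sample `i` of a different law keeps the weight `n i * n
  -- l / (2T)` of order `N`, because `T ≤ (k + 1) * n l`.
  obtain ⟨l, hl⟩ := Finite.exists_max n
  obtain ⟨i, hi⟩ : ∃ i, F i ≠ F l := by
    by_contra! h
    obtain ⟨i, j, hij⟩ := hne
    exact hij ((h i).trans (h j).symm)
  have hil : i ≠ l := fun e => hi (by rw [e])
  have hS := mul_energyDist_le_multiEnergyDist h0 h2 hn0 U hil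
  have hE := hcE _ _ (U i) (U l) (hn0 i) (hn0 l)
  have hpair := integral_norm_charFun_sub_sq_le (F i) (F l) (U i) (U l)
  have hδ' := hδF i l hi
  have hR : (∫ t, charFunError (F i) (U i) t ∂Λ) + ∫ t, charFunError (F l) (U l) t ∂Λ ≤
      totalCharFunError F U := by
    have := Finset.sum_le_univ_sum_of_nonneg (s := {i, l})
      (f := fun j => ∫ t, charFunError (F j) (U j) t ∂Λ)
      (fun j => integral_nonneg fun t => charFunError_nonneg _ _ t)
    rwa [Finset.sum_pair hil] at this
  set X := ∫ t, empFourierDist (U i) (U l) t ∂Λ with hX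
  have hXge : δ / 3 - totalCharFunError F U ≤ X := by linarith
  have hT0 : (0 : ℝ) < totalSize n := by exact_mod_cast totalSize_pos hn0
  have hTl : (totalSize n : ℝ) ≤ (k + 1) * n l := by
    have : totalSize n ≤ (k + 1) * n l := by
      calc totalSize n ≤ ∑ _j : Fin (k + 1), n l := Finset.sum_le_sum fun j _ => hl j
        _ = _ := by simp
    exact_mod_cast this
  have hi0 : (0 : ℝ) < n i := by exact_mod_cast hn0 i
  have hl0 : (0 : ℝ) < n l := by exact_mod_cast hn0 l
  have hNi : (N : ℝ) ≤ n i := by exact_mod_cast hn i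
  refine le_trans ?_ hS
  set Y := 2 * meanDist α (U i) (U l) - meanDist α (U i) (U i) - meanDist α (U l) (U l) with hY
  have hrew : ((n i : ℝ) + n l) / (2 * totalSize n) * energyDist α (U i) (U l) =
      n i * n l / (2 * totalSize n) * Y := by
    rw [energyDist, ← hY]; field_simp
  have hd : 0 < δ / 3 - totalCharFunError F U := by linarith
  have hcoef : (N : ℝ) / (2 * (k + 1)) ≤ n i * n l / (2 * totalSize n) := by
    rw [div_le_div_iff₀ (by positivity) (by positivity)]
    have := mul_le_mul hNi hTl hT0.le hi0.le
    linarith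
  rw [hrew]
  calc c / (2 * (k + 1)) * N * (δ / 3 - totalCharFunError F U)
      = N / (2 * (k + 1)) * (c * (δ / 3 - totalCharFunError F U)) := by ring
    _ ≤ n i * n l / (2 * totalSize n) * Y := by
        refine mul_le_mul hcoef ?_ (by positivity) (by positivity)
        exact (mul_le_mul_of_nonneg_left hXge hc.le).trans hE

/-- The product form of the hypothesis also covers a vanishing within-sample dispersion, where it
forces a positive numerator and the statistic is `∞`. -/
theorem lt_ratioStat {α c : ℝ} (hk : 1 ≤ k) (hc : 0 ≤ c) {U : Samples q n}
    (h : c * (withinDispersion α U / ((totalSize n : ℝ) - k - 1)) * k < multiEnergyDist α U)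
    (hm : 0 < (totalSize n : ℝ) - k - 1) :
    ENNReal.ofReal c < ratioStat α U := by
  have hk' : (0 : ℝ) < k := by exact_mod_cast hk
  have hW := div_nonneg (withinDispersion_nonneg α U) hm.le
  have hS : 0 < multiEnergyDist α U := lt_of_le_of_lt (by positivity) h
  have hS' : 0 < multiEnergyDist α U / k := div_pos hS hk'
  rw [ratioStat, ENNReal.lt_div_iff_mul_lt (Or.inr ENNReal.ofReal_ne_top)
    (Or.inl ENNReal.ofReal_ne_top), ← ENNReal.ofReal_mul hc,
    ENNReal.ofReal_lt_ofReal_iff hS', lt_div_iff₀ hk']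
  exact h

/-- Under a fixed alternative, the probability not to reject is at most inversely proportional to
the smallest sample size. -/
theorem exists_le_rejectionProb {α : ℝ} (h0 : 0 < α) (h2 : α < 2) (hk : 1 ≤ k)
    (hF : ∀ j, Integrable (fun x => ‖x‖ ^ 2) (F j)) (hne : ∃ i j, F i ≠ F j) {c : ℝ}
    (hc : 0 < c) :
    ∃ C : ℝ, ∀ (N : ℕ) (n : Fin (k + 1) → ℕ), 2 ≤ N → (∀ j, N ≤ n j) →
      ENNReal.ofReal (1 - C / N) ≤ rejectionProb α n (ENNReal.ofReal c) F := by
  obtain ⟨c₀, δ, hc₀, hδ, hS⟩ := exists_mul_sub_le_multiEnergyDist F h0 h2 hne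
  have hk' : (0 : ℝ) < k := by exact_mod_cast hk
  set L := (gaussWeight (EuclideanSpace ℝ (Fin q))).real Set.univ with hL
  set M := 1 / 2 + 2 * ∑ j, ∫ x, ‖x‖ ^ 2 ∂F j with hM
  have hM0 : 0 ≤ M := add_nonneg (by norm_num) (mul_nonneg (by norm_num)
    (Finset.sum_nonneg fun j _ => integral_nonneg fun x => by positivity))
  refine ⟨2 * (k + 1) * L / (δ / 2) + 4 * M * c * k / (c₀ * δ), fun N n hN hn => ?_⟩
  have hN0 : 0 < N := by omega
  have hN' : (0 : ℝ) < N := by exact_mod_cast hN0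
  have hn0 : ∀ j, 0 < n j := fun j => hN0.trans_le (hn j)
  have hT : 2 * ((k : ℝ) + 1) ≤ totalSize n := by
    have : (k + 1) * 2 ≤ totalSize n := by
      calc (k + 1) * 2 = ∑ _j : Fin (k + 1), 2 := by simp
        _ ≤ _ := Finset.sum_le_sum fun j _ => hN.trans (hn j)
    have : (((k + 1) * 2 : ℕ) : ℝ) ≤ totalSize n := by exact_mod_cast this
    push_cast at this
    linarith
  set T : ℝ := (totalSize n : ℝ) with hTdef
  have hm : 0 < T - k - 1 := by linarith
  set P := sampleLaw n F with hP
  -- This is the within-sample dispersion at which the statistic would equal `c` if the multi-sample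
  -- energy distance were `c₀ * N * (δ / 2)`. Failure to reject thus needs a large characteristic
  -- function error or a dispersion of at least `x`; Markov's inequality bounds both probabilities
  -- by multiples of `1 / N`.
  set x := c₀ * N * (δ / 2) / (c * k) * (T - k - 1) with hx
  have hx0 : 0 < x := by positivity
  have hcover : (Set.univ : Set (Samples q n)) ⊆ {U | ENNReal.ofReal c < ratioStat α U} ∪
      ({U | δ / 2 ≤ totalCharFunError F U} ∪ {U | x ≤ withinDispersion α U}) := by
    intro U _
    by_contra hU
    simp only [Set.mem_union, Set.mem_ofPred_eq, not_or, not_le] at hU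
    obtain ⟨h1, h3, h4⟩ := hU
    refine h1 (lt_ratioStat hk hc.le ?_ hm)
    rw [← hTdef]
    calc c * (withinDispersion α U / (T - k - 1)) * k < c * (x / (T - k - 1)) * k := by gcongr
      _ = c₀ * N * (δ / 2) := by rw [hx]; field_simp
      _ ≤ c₀ * N * (δ - totalCharFunError F U) := by gcongr; linarith
      _ ≤ _ := hS N n hN0 hn U
  have hA : P.real {U | δ / 2 ≤ totalCharFunError F U} ≤ 2 * (k + 1) * L / (δ / 2) / N := by
    have h := mul_meas_ge_le_integral_of_nonneg (μ := P) (ae_of_all _ fun U : Samples q n =>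
      Finset.sum_nonneg fun j _ => integral_nonneg fun t => charFunError_nonneg (F j) (U j) t)
      (integrable_totalCharFunError F) (δ / 2)
    have h' := h.trans (integral_totalCharFunError_le F hN0 hn)
    rw [mul_comm, ← le_div_iff₀ (by positivity)] at h'
    exact h'.trans (le_of_eq (div_right_comm _ _ _))
  have hB : P.real {U | x ≤ withinDispersion α U} ≤ 4 * M * c * k / (c₀ * δ) / N := by
    have h := mul_meas_ge_le_integral_of_nonneg (μ := P)
      (ae_of_all _ fun U : Samples q n => withinDispersion_nonneg α U)
      (integrable_withinDispersion h0 h2 hn0 hF) x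
    have h' := h.trans (integral_withinDispersion_le h0 h2 hn0 hF)
    rw [mul_comm, ← le_div_iff₀ hx0, ← hM, ← hTdef] at h'
    refine h'.trans ?_
    rw [div_div, div_le_div_iff₀ hx0 (by positivity), hx]
    -- Here `2 ≤ N` is used: it makes `T` at least `2 (k + 1)`, so the degrees of freedom are
    -- comparable to `T`.
    have hTm : T ≤ 2 * (T - k - 1) := by linarith
    calc T * M * (c₀ * δ * N) ≤ 2 * (T - k - 1) * M * (c₀ * δ * N) := by gcongr
      _ = _ := by field_simp; ring
  have hprob : 1 ≤ P.real {U | ENNReal.ofReal c < ratioStat α U} +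
      (P.real {U | δ / 2 ≤ totalCharFunError F U} + P.real {U | x ≤ withinDispersion α U}) := by
    calc (1 : ℝ) = P.real Set.univ := by simp
      _ ≤ _ := measureReal_mono hcover
      _ ≤ _ := measureReal_union_le _ _
      _ ≤ _ := by gcongr; exact measureReal_union_le _ _
  rw [rejectionProb, ← ofReal_measureReal]
  refine ENNReal.ofReal_le_ofReal ?_
  rw [add_div]
  linarith

theorem tendsto_rejectionProb {α : ℝ} (h0 : 0 < α) (h2 : α < 2) (hk : 1 ≤ k)
    (hF : ∀ j, Integrable (fun x => ‖x‖ ^ 2) (F j)) (hne : ∃ i j, F i ≠ F j) {a : ℝ} (ha : 0 < a)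
    {n : ℕ → Fin (k + 1) → ℕ} (hn : ∀ j, Tendsto (fun m => n m j) atTop atTop) :
    Tendsto (fun m => rejectionProb α (n m) (criticalValue q α (n m) a) F) atTop (𝓝 1) := by
  obtain ⟨C, hC⟩ := exists_le_rejectionProb F h0 h2 hk hF hne (c := 2 / a) (by positivity)
  have hlim : Tendsto (fun N : ℕ => ENNReal.ofReal (1 - C / N)) atTop (𝓝 1) := by
    have : Tendsto (fun N : ℕ => 1 - C / (N : ℝ)) atTop (𝓝 (1 - 0)) :=
      (tendsto_const_div_atTop_nhds_zero_nat C).const_sub 1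
    simpa using ENNReal.tendsto_ofReal this
  refine tendsto_order.2 ⟨fun b hb => ?_, fun b hb => ?_⟩
  -- A single `N` suffices, since the bound holds for all sizes at least `N`. The ceiling condition
  -- gives `2 / a * k ≤ T - 1`, so the critical value is at most `2 / a` and the test rejects
  -- whenever the statistic exceeds that fixed threshold.
  · obtain ⟨N, hbN, hN2, hNa⟩ := ((hlim.eventually_const_lt hb).and ((eventually_ge_atTop 2).and
      (eventually_ge_atTop (⌈2 / a * k⌉₊ + 1)))).exists
    filter_upwards [eventually_all.2 fun j => (hn j).eventually_ge_atTop N] with m hm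
    refine hbN.trans_le ((hC N (n m) hN2 hm).trans (measure_mono fun U hU => ?_))
    refine lt_of_le_of_lt (b := ENNReal.ofReal (2 / a)) ?_ hU
    have hN0 : ∀ j, 0 < n m j := fun j => by have := hm j; omega
    have hT1 : (k + 1) * 2 ≤ totalSize (n m) := by
      calc (k + 1) * 2 = ∑ _j : Fin (k + 1), 2 := by simp
        _ ≤ _ := Finset.sum_le_sum fun j _ => hN2.trans (hm j)
    have hT2 : N ≤ totalSize (n m) :=
      (hm 0).trans (Finset.single_le_sum (fun j _ => Nat.zero_le _) (Finset.mem_univ 0))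
    refine criticalValue_le h0 h2 hk hN0 ?_ ha ?_
    · exact_mod_cast (by omega : k + 1 < totalSize (n m))
    · have h3 : ((⌈2 / a * k⌉₊ + 1 : ℕ) : ℝ) ≤ totalSize (n m) := by
        exact_mod_cast hNa.trans hT2
      push_cast at h3
      linarith [Nat.le_ceil (2 / a * (k : ℝ))]
  · exact Eventually.of_forall fun m => lt_of_le_of_lt prob_le_one hb

end Alternative

end EnergyTest

end

theorem proposition3 (q k : ℕ) (hk : 1 ≤ k) :
    -- the decomposition of the total dispersion
    (∀ α : ℝ, 0 < α → ∀ n : Fin (k + 1) → ℕ, (∀ j, 0 < n j) →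
      ∀ U : EnergyTest.Samples q n,
        EnergyTest.totalDispersion α U =
          EnergyTest.multiEnergyDist α U + EnergyTest.withinDispersion α U) ∧
    -- consistency, at every level, of the test that rejects for large values of the statistic
    (∀ α : ℝ, 0 < α → α < 2 → ∀ a : ℝ, 0 < a → a < 1 →
      (∀ n : Fin (k + 1) → ℕ, (∀ j, 0 < n j) →
        ∀ G : Measure (EuclideanSpace ℝ (Fin q)), IsProbabilityMeasure G →
          EnergyTest.rejectionProb α n (EnergyTest.criticalValue q α n a) (fun _ => G) ≤
            ENNReal.ofReal a) ∧
      (∀ F : Fin (k + 1) → Measure (EuclideanSpace ℝ (Fin q)),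
        (∀ j, IsProbabilityMeasure (F j)) →
        (∀ j, Integrable (fun x => ‖x‖ ^ 2) (F j)) →
        (∃ i j, F i ≠ F j) →
        ∀ n : ℕ → Fin (k + 1) → ℕ, (∀ j, Tendsto (fun m => n m j) atTop atTop) →
          Tendsto
            (fun m => EnergyTest.rejectionProb α (n m)
              (EnergyTest.criticalValue q α (n m) a) F)
            atTop (𝓝 1))) := by
  refine ⟨fun α _ n hn U => EnergyTest.totalDispersion_eq_add hn α U,
    fun α h0 h2 a ha _ => ⟨fun n _ G hG => EnergyTest.rejectionProb_criticalValue_le α n a G hG,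
      fun F _ hF hne n hn => EnergyTest.tendsto_rejectionProb F h0 h2 hk hF hne ha hn⟩⟩
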